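/- **Theorem (Outer bound for weak secrecy).** A *secure network coding problem* $\mathsf P$ consists of finite sets $\mathcal V$ (nodes), $\mathcal E$ (hyperedges) and $\mathcal S$ (sources); for each $e\in\mathcal E$ a tail $\mathrm{tail}(e)\in\mathcal V$ and a head $\mathrm{head}(e)\subseteq\mathcal V$, without directed cycles; for each source $s$ a set $O(s)\subseteq\mathcal V$ of nodes where it is available and a set $D(s)\subseteq\mathcal V$ of nodes where it is to be decoded; and a family of pairs $(\mathcal A_r,\mathcal B_r)_{r\in\mathcal R}$ with $\mathcal A_r\subseteq\mathcal S$, $\mathcal B_r\subseteq\mathcal E$ (adversary $r$ observes $\mathcal B_r$ and wants to learn $\mathcal A_r$). For $u\in\mathcal V$ let $\mathrm{in}(u)=\{s\in\mathcal S: u\in O(s)\}\cup\{e\in\mathcal E: u\in \mathrm{head}(e)\}$, and $\mathrm{in}(e)=\mathrm{in}(\mathrm{tail}(e))$ for $e\in\mathcal E$. Let $\mathcal N=\mathcal S\sqcup\mathcal E\sqcup\mathcal V$. For a function $h:2^{\mathcal N}\to\mathbb R$ write $h(\alpha\mid\beta)=h(\alpha\cup\beta)-h(\beta)$ and $h(\alpha\wedge\beta)=h(\alpha)+h(\beta)-h(\alpha\cup\beta)$.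 Call $h$ *entropic* if $h(\alpha)=H(Y_i,i\in\alpha)$ for some jointly distributed discrete random variables $(Y_i)_{i\in\mathcal N}$ with finite entropies, *weakly entropic* if $c\,h$ is entropic for some $c>0$, and *almost entropic* if it is a pointwise limit of a sequence of weakly entropic functions; $\bar\Gamma^*$ is the set of almost entropic functions. Let - $\mathcal C_{\sf I}=\{h: h(\mathcal S\cup\mathcal V)=\sum_{s\in\mathcal S}h(s)+\sum_{u\in\mathcal V}h(u)\}$, - $\mathcal C_{\sf T}=\{h: h(e\mid \mathrm{in}(e)\cup\{\mathrm{tail}(e)\})=0\ \forall e\in\mathcal E\}$, - $\mathcal C_{\sf D}=\{h: h(s\mid \mathrm{in}(u))=0\ \forall s\in\mathcal S,\ u\in D(s)\}$, - $\mathcal C_{\sf S}=\{h: h(\mathcal A_r\wedge\mathcal B_r)=0\ \forall r\in\mathcal R\}$. A *stochastic network code* is a family $(Y_f)_{f\in\mathcal N}$ of jointly distributed discrete random variables with finite entropies whose entropy function lies in $\mathcal C_{\sf I}\cap\mathcal C_{\sf T}$ and for which each $Y_s$, $s\in\mathcal S$, is uniform on its support. A rate-capacity tuple $(\lambda,\omega)\in\mathbb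 R_{\ge0}^{\mathcal S}\times\mathbb R_{\ge0}^{\mathcal E}$ is *$\epsilon$-achievable subject to weak secrecy* if there are stochastic network codes $(Y^n_f)$ and reals $c_n>0$ such that, with $\mathsf{SP}$ denoting the support (finite for all sources and hyperedges), 1. for all $e$ and $s$ the limits exist in $\mathbb R$ and $\lim_n c_n\log|\mathsf{SP}(Y^n_e)|\le\omega(e)$, $\lim_n c_n\log|\mathsf{SP}(Y^n_s)|\ge\lambda(s)$; 2. for all $s\in\mathcal S$, $u\in D(s)$ there are functions $g^n_{s,u}$ with $\lim_n\Pr\big(Y^n_s\ne g^n_{s,u}(Y^n_f: f\in\mathrm{in}(u))\big)=0$; 3. for all $r\in\mathcal R$, $\lim_n c_n I(Y^n_{\mathcal A_r};Y^n_{\mathcal B_r})=0$. If $(\lambda,\omega)$ is $\epsilon$-achievable subject to weak secrecy, then there is $h\in K:=\bar\Gamma^*\cap\mathcal C_{\sf I}\cap\mathcal C_{\sf T}\cap\mathcal C_{\sf D}\cap\mathcal C_{\sf S}$ with $\lambda(s)\le h(s)$ for all $s\in\mathcal S$ and $\omega(e)\ge h(e)$ for all $e\in\mathcal E$. Moreover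 $(\lambda,\omega)\in\mathsf{CL}(\mathrm{proj}[K])$, where $\mathrm{proj}[h]=(h(s),s\in\mathcal S;\ h(e),e\in\mathcal E)$ and $\mathsf{CL}(T)$ is the set of rate-capacity tuples $(\lambda,\omega)$ for which there are $(\lambda^n,\omega^n)\in T$ and $c_n>0$ such that for all $e$ and $s$ the limits exist in $\mathbb R$ and $\lim_n c_n\omega^n(e)\le\omega(e)$, $\lim_n c_n\lambda^n(s)\ge\lambda(s)$. -/

import Mathlib

open Filter Topology

noncomputable section

namespace SecureNC

/-! ### Discrete random variables and entropy functions -/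

/-- A family of jointly distributed discrete random variables `Y i`, `i : N`, given by their
alphabets and their joint law. (A `PMF` has countable support, so these are exactly the joint
laws of discrete random variables; the alphabets themselves may be infinite.) -/
structure RandomVars (N : Type*) where
  alphabet : N → Type
  law : PMF (∀ i, alphabet i)

namespace RandomVars

variable {N : Type*}

/-- The law of the subfamily `(Y i, i ∈ A)`. -/
def marginal (Y : RandomVars N) (A : Set N) : PMF (∀ i : A, Y.alphabet i) :=
  Y.law.map fun y i => y i

/-- The law of the single variable `Y i`. -/
def single (Y : RandomVars N) (i : N) : PMF (Y.alphabet i) :=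
  Y.law.map fun y => y i

/-- The support of `Y i`: the values it takes with positive probability. -/
def supp (Y : RandomVars N) (i : N) : Set (Y.alphabet i) :=
  (Y.single i).support

/-- All joint Shannon entropies of the family are finite. -/
def FiniteEntropy (Y : RandomVars N) : Prop :=
  ∀ A : Set N, Summable fun y => Real.negMulLog (Y.marginal A y).toReal

/-- The entropy function `A ↦ H(Y i, i ∈ A)` (in nats), meaningful under `FiniteEntropy`. -/
def entropy (Y : RandomVars N) (A : Set N) : ℝ :=
  ∑' y, Real.negMulLog (Y.marginal A y).toReal

/-- `Y i` is uniformly distributed over its support. -/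
def IsUniform (Y : RandomVars N) (i : N) : Prop :=
  ∀ a ∈ Y.supp i, ∀ b ∈ Y.supp i, Y.single i a = Y.single i b

end RandomVars

/-- Rank functions on `N`: real functions of the subsets of `N`, with the topology of
pointwise convergence. -/
abbrev RankFun (N : Type*) := Set N → ℝ

/-- `h(A | B) = h(A ∪ B) - h(B)`. -/
def condRank {N : Type*} (h : RankFun N) (A B : Set N) : ℝ := h (A ∪ B) - h B

/-- `h(A ∧ B) = h(A) + h(B) - h(A ∪ B)`. -/
def mutualRank {N : Type*} (h : RankFun N) (A B : Set N) : ℝ := h A + h B - h (A ∪ B)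

/-- `h` is the entropy function of a family of discrete random variables (`Γ*`). -/
def Entropic {N : Type*} (h : RankFun N) : Prop :=
  ∃ Y : RandomVars N, Y.FiniteEntropy ∧ h = Y.entropy

/-- Some positive multiple of `h` is entropic. -/
def WeaklyEntropic {N : Type*} (h : RankFun N) : Prop :=
  ∃ c : ℝ, 0 < c ∧ Entropic (c • h)

/-- The set of almost entropic functions: limits of sequences of weakly entropic functions. -/
def almostEntropic (N : Type*) : Set (RankFun N) :=
  {h | ∃ hseq : ℕ → RankFun N, (∀ n, WeaklyEntropic (hseq n)) ∧ Tendsto hseq atTop (𝓝 h)}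

/-! ### Secure network coding problems -/

/-- A secure network coding problem with nodes `V`, hyperedges `E`, sources `S` and
adversaries `R`. -/
structure Problem (V E S R : Type*) where
  /-- transmitting node of a hyperedge -/
  tail : E → V
  /-- receiving nodes of a hyperedge -/
  head : E → Set V
  /-- there are no directed cycles -/
  acyclic : ∀ e, ¬ Relation.TransGen (fun f g => tail g ∈ head f) e e
  /-- nodes at which a source is available -/
  origin : S → Set V
  /-- nodes at which a source has to be reconstructed -/
  dest : S → Set V
  /-- sources that an adversary wants to learn -/
  target : R → Set S
  /-- hyperedges that an adversary observes -/
  wiretap : R → Set E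

/-- The disjoint union of sources, hyperedges and nodes. -/
abbrev Idx (V E S : Type*) := S ⊕ E ⊕ V

section Idx

variable {V E S : Type*}

/-- the index of a source -/
def src (s : S) : Idx V E S := Sum.inl s

/-- the index of a hyperedge -/
def edge (e : E) : Idx V E S := Sum.inr (Sum.inl e)

/-- the index of (the random key of) a node -/
def node (u : V) : Idx V E S := Sum.inr (Sum.inr u)

end Idx

/-- Tuples of source rates and hyperedge capacities. -/
abbrev Tuple (E S : Type*) := (S → ℝ) × (E → ℝ)

/-- The set of rate-capacity tuples: all entries are nonnegative. -/
def rateCapacity (E S : Type*) : Set (Tuple E S) :=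
  {t | (∀ s, 0 ≤ t.1 s) ∧ ∀ e, 0 ≤ t.2 e}

/-- `CL(K)`: rate-capacity tuples `(lam, om)` for which there are tuples `(lamⁿ, omⁿ)` in `K`
and `cₙ > 0` with `lim cₙ omⁿ(e) ≤ om(e)` and `lim cₙ lamⁿ(s) ≥ lam(s)`. -/
def CL {E S : Type*} (K : Set (Tuple E S)) : Set (Tuple E S) :=
  {t | t ∈ rateCapacity E S ∧ ∃ (tseq : ℕ → Tuple E S) (c : ℕ → ℝ),
    (∀ n, tseq n ∈ K) ∧ (∀ n, 0 < c n) ∧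
    (∀ e, ∃ l, Tendsto (fun n => c n * (tseq n).2 e) atTop (𝓝 l) ∧ l ≤ t.2 e) ∧
    (∀ s, ∃ l, Tendsto (fun n => c n * (tseq n).1 s) atTop (𝓝 l) ∧ t.1 s ≤ l)}

/-- The coordinate projection of a rank function to the sources and the hyperedges. -/
def proj {V E S : Type*} (h : RankFun (Idx V E S)) : Tuple E S :=
  (fun s => h {src s}, fun e => h {edge e})

namespace Problem

variable {V E S R : Type*} (P : Problem V E S R)

/-- `in(u)`: the sources and hyperedges incoming to the node `u`. -/
def inc (u : V) : Set (Idx V E S) :=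
  src '' {s | u ∈ P.origin s} ∪ edge '' {e | u ∈ P.head e}

/-- Independence constraint on sources and random keys. -/
def CI [Fintype S] [Fintype V] (_P : Problem V E S R) : Set (RankFun (Idx V E S)) :=
  {h | h (Set.range src ∪ Set.range node) = ∑ s : S, h {src s} + ∑ u : V, h {node u}}

/-- Topology constraint: each edge message is determined by the messages incoming to its tail
and the random key of its tail. -/
def CT : Set (RankFun (Idx V E S)) :=
  {h | ∀ e, condRank h {edge e} (P.inc (P.tail e) ∪ {node (P.tail e)}) = 0}

/-- Decoding constraint. -/
def CD : Set (RankFun (Idx V E S)) :=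
  {h | ∀ s, ∀ u ∈ P.dest s, condRank h {src s} (P.inc u) = 0}

/-- Secrecy constraint. -/
def CS : Set (RankFun (Idx V E S)) :=
  {h | ∀ r, mutualRank h (src '' P.target r) (edge '' P.wiretap r) = 0}

/-- Stochastic network codes: sources `Y (src s)`, edge messages `Y (edge e)` and local random
keys `Y (node u)`. -/
structure IsStochasticCode [Fintype S] [Fintype V] (Y : RandomVars (Idx V E S)) : Prop where
  finiteEntropy : Y.FiniteEntropy
  uniform : ∀ s, Y.IsUniform (src s)
  independent : Y.entropy ∈ P.CI
  topology : Y.entropy ∈ P.CT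

/-- Vanishing-error achievability subject to weak secrecy. The limits of `cₙ log |SP(Yⁿ)|` are
limits of real numbers, so the edge messages have finite support (for a source this follows
from uniformity). -/
def EpsAchievable [Fintype S] [Fintype V] (t : Tuple E S) : Prop :=
  ∃ (Y : ℕ → RandomVars (Idx V E S)) (c : ℕ → ℝ),
    (∀ n, P.IsStochasticCode (Y n)) ∧ (∀ n, 0 < c n) ∧
    (∀ n e, ((Y n).supp (edge e)).Finite) ∧
    (∀ e, ∃ l, Tendsto (fun n => c n * Real.log ((Y n).supp (edge e)).ncard) atTop (𝓝 l) ∧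
      l ≤ t.2 e) ∧
    (∀ s, ∃ l, Tendsto (fun n => c n * Real.log ((Y n).supp (src s)).ncard) atTop (𝓝 l) ∧
      t.1 s ≤ l) ∧
    (∀ s, ∀ u ∈ P.dest s,
      ∃ g : ∀ n, (∀ f : P.inc u, (Y n).alphabet f) → (Y n).alphabet (src s),
        Tendsto (fun n => (Y n).law.toOuterMeasure {y | y (src s) ≠ g n fun f => y f})
          atTop (𝓝 0)) ∧
    (∀ r, Tendsto (fun n => c n *
      mutualRank (Y n).entropy (src '' P.target r) (edge '' P.wiretap r)) atTop (𝓝 0))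

/-- Almost entropic functions on sources, hyperedges and nodes that satisfy all constraints. -/
def outerRegion [Fintype S] [Fintype V] : Set (RankFun (Idx V E S)) :=
  almostEntropic (Idx V E S) ∩ P.CI ∩ P.CT ∩ P.CD ∩ P.CS

end Problem

end SecureNC

end

/-! The natural candidate for `h` is a limit of the scaled entropy functions `c n • H(Yⁿ)`. All
constraints pass to such a limit: independence and topology are linear equalities, decoding follows
from Fano's inequality, and secrecy is the hypothesis of weak secrecy. Uniform sources have entropy
exactly `log |SP|`, while edge messages have entropy at most `log |SP|`, which gives the two rate
inequalities.

The obstacle is compactness. The scaled logarithmic alphabet sizes of sources and edges converge,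
but nothing bounds the entropies of the local keys. Each code is therefore replaced by one with
small keys and the same joint law of sources and edge messages. For a key `u`, the law of the
messages is the sum over key values `k` of the vectors `x ↦ Pr(message = x, key = k)`. These lie in
a space whose dimension is the number of message values. The sum is a nonnegative combination of at
most that many of the vectors (`mem_span_nnreal_of_hasSum` and Carathéodory's theorem for cones),
even when there are infinitely many key values. The coefficients define a density depending on the
key alone (`exists_reduce_coord`). Reweighting by it keeps the law of the messages, keeps the
independence of sources and keys because the density involves one coordinate, and keeps every
functional dependence because the support only shrinks.

After all keys are treated, every joint entropy is at most `(1 + |V|)` times the total logarithmic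
message size (`exists_reduced_keys`). The scaled entropy functions then stay in a compact box, and
the limit of a convergent subsequence is the required `h`. -/

namespace SecureNC

/-! ### Finite subsums of convergent series in finite dimension -/

/-- Weak separation of a point from a spanning convex cone in finite dimension. -/
theorem exists_clm_of_notMem_span_nnreal {ι F : Type*} [NormedAddCommGroup F] [NormedSpace ℝ F]
    [FiniteDimensional ℝ F] {v : ι → F} (hv : Submodule.span ℝ (Set.range v) = ⊤) {b : F}
    (hb : b ∉ Submodule.span NNReal (Set.range v)) :
    ∃ f : F →L[ℝ] ℝ, f ≠ 0 ∧ 0 ≤ f b ∧ ∀ i, f (v i) ≤ 0 := by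
  set C : Submodule NNReal F := Submodule.span NNReal (Set.range v) with hC
  have hconv : Convex ℝ (C : Set F) := by
    intro x hx y hy a c ha hc _
    exact C.add_mem (C.smul_mem ⟨a, ha⟩ hx) (C.smul_mem ⟨c, hc⟩ hy)
  -- The cone contains 0, so its affine span is its linear span, the whole space.
  have hint : (interior (C : Set F)).Nonempty := by
    rw [hconv.interior_nonempty_iff_affineSpan_eq_top]
    have : Submodule.span ℝ (C : Set F) = ⊤ := by
      rw [eq_top_iff, ← hv]
      exact Submodule.span_mono Submodule.subset_span
    have h := affineSpan_insert_zero (k := ℝ) (C : Set F)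
    rw [Set.insert_eq_of_mem (SetLike.mem_coe.2 C.zero_mem), this] at h
    exact SetLike.coe_injective (by simpa using h)
  obtain ⟨f, hf⟩ := geometric_hahn_banach_open_point hconv.interior isOpen_interior
    (fun h => hb (interior_subset h))
  have hle : ∀ x ∈ C, f x ≤ f b := by
    intro x hx
    have hx' : x ∈ closure (interior (C : Set F)) := by
      rw [hconv.closure_interior_eq_closure_of_nonempty_interior hint]
      exact subset_closure hx
    exact closure_minimal (fun y hy => (hf y hy).le) (isClosed_le f.continuous continuous_const) hx'
  refine ⟨f, ?_, by simpa using hle 0 C.zero_mem, fun i => ?_⟩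
  · rintro rfl
    obtain ⟨x, hx⟩ := hint
    simpa using hf x hx
  -- A positive value on a generator would exceed `f b` on a large multiple of it.
  · by_contra! hpos
    obtain ⟨n, hn⟩ := exists_nat_gt (f b / f (v i))
    have := hle (((n : NNReal)) • v i) (C.smul_mem _ (Submodule.subset_span ⟨i, rfl⟩))
    rw [NNReal.smul_def, map_smul, smul_eq_mul] at this
    rw [div_lt_iff₀ hpos] at hn
    simp at this
    linarith

/-- The cone need not be closed, so approximation by partial sums is not enough. Under a separating
functional the terms are nonpositive but their sum is nonnegative, so all of them vanish, and the
functional is zero on a spanning set. -/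
theorem mem_span_nnreal_of_hasSum_of_span_eq_top {ι F : Type*} [NormedAddCommGroup F]
    [NormedSpace ℝ F] [FiniteDimensional ℝ F] {v : ι → F}
    (hv : Submodule.span ℝ (Set.range v) = ⊤) {b : F} (hb : HasSum v b) :
    b ∈ Submodule.span NNReal (Set.range v) := by
  by_contra hmem
  obtain ⟨f, hf0, hfb, hfv⟩ := exists_clm_of_notMem_span_nnreal hv hmem
  have hs : HasSum (fun i => f (v i)) (f b) := f.hasSum hb
  have hs0 : f b = 0 := le_antisymm (hs.nonpos hfv) hfb
  have hz : (fun i => -f (v i)) = 0 := by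
    refine (hasSum_zero_iff_of_nonneg (fun i => ?_)).1 (by simpa [hs0] using hs.neg)
    simpa using hfv i
  apply hf0
  have : (f : F →ₗ[ℝ] ℝ) = 0 := by
    refine LinearMap.ext_on_range hv fun i => ?_
    simpa using congrFun hz i
  ext x
  exact LinearMap.congr_fun this x

/-- The sum of a convergent series in a finite-dimensional space is a nonnegative combination of
finitely many of its terms. -/
theorem mem_span_nnreal_of_hasSum {ι F : Type*} [NormedAddCommGroup F]
    [NormedSpace ℝ F] [FiniteDimensional ℝ F] {v : ι → F} {b : F} (hb : HasSum v b) :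
    b ∈ Submodule.span NNReal (Set.range v) := by
  -- Inside their own span the terms are spanning, and the sum lies there because a
  -- finite-dimensional subspace is closed.
  set W := Submodule.span ℝ (Set.range v) with hW
  have hvW : ∀ i, v i ∈ W := fun i => Submodule.subset_span ⟨i, rfl⟩
  have hbW : b ∈ W := by
    refine (Submodule.closed_of_finiteDimensional W).mem_of_tendsto hb (Eventually.of_forall ?_)
    exact fun s => W.sum_mem fun i _ => hvW i
  let v' : ι → W := fun i => ⟨v i, hvW i⟩
  have hr : W.subtype '' Set.range v' = Set.range v := by
    rw [← Set.range_comp]; rfl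
  have hspan : Submodule.span ℝ (Set.range v') = ⊤ := by
    apply Submodule.map_injective_of_injective W.injective_subtype
    rw [Submodule.map_span, hr, Submodule.map_top, Submodule.range_subtype]
  have hb' : HasSum v' ⟨b, hbW⟩ := by
    rw [← Topology.IsInducing.subtypeVal.hasSum_iff (g := W.subtype)]
    exact hb
  have := mem_span_nnreal_of_hasSum_of_span_eq_top hspan hb'
  have h2 := Submodule.mem_map_of_mem (f := W.subtype.restrictScalars NNReal) this
  rw [Submodule.map_span] at h2
  rwa [show (W.subtype.restrictScalars NNReal : W → F) '' Set.range v' = Set.range v from hr] at h2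

/-- One step of the reduction in Carathéodory's theorem for cones. -/
theorem exists_erase_of_sum_smul_eq {ι F : Type*} [AddCommGroup F] [Module ℝ F] [DecidableEq ι]
    {v : ι → F} {t : Finset ι} {r g : ι → ℝ} (hr : ∀ i ∈ t, 0 ≤ r i)
    (hg : ∑ i ∈ t, g i • v i = 0) {i₀ : ι} (hi₀ : i₀ ∈ t) (hgi : 0 < g i₀) :
    ∃ i ∈ t, ∃ r' : ι → ℝ, (∀ j ∈ t.erase i, 0 ≤ r' j) ∧
      ∑ j ∈ t.erase i, r' j • v j = ∑ j ∈ t, r j • v j := by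
  -- The minimal ratio is the largest multiple of the relation `g` that can be subtracted with all
  -- coefficients staying nonnegative; the coefficient at the minimiser becomes zero.
  obtain ⟨i, hi, hmin⟩ := (t.filter fun i => 0 < g i).exists_min_image (fun i => r i / g i)
    ⟨i₀, by simp [hi₀, hgi]⟩
  rw [Finset.mem_filter] at hi
  refine ⟨i, hi.1, fun j => r j - r i / g i * g j, fun j hj => ?_, ?_⟩
  · have hjt := Finset.mem_of_mem_erase hj
    rcases le_or_gt (g j) 0 with h | h
    · have := mul_nonpos_of_nonneg_of_nonpos (div_nonneg (hr i hi.1) hi.2.le) h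
      have := hr j hjt
      linarith
    · have := hmin j (by simp [hjt, h])
      rw [le_div_iff₀ h] at this
      linarith
  · have h0 : (r i - r i / g i * g i) • v i = 0 := by
      rw [div_mul_cancel₀ _ hi.2.ne', sub_self, zero_smul]
    rw [Finset.sum_erase t (f := fun j => (r j - r i / g i * g j) • v j) h0]
    simp only [sub_smul, mul_smul, Finset.sum_sub_distrib]
    rw [← Finset.smul_sum, hg, smul_zero, sub_zero]

/-- Carathéodory's theorem for cones. -/
theorem exists_finset_card_le_of_mem_span_nnreal {ι F : Type*} [AddCommGroup F] [Module ℝ F]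
    [FiniteDimensional ℝ F] {v : ι → F} {b : F} (hb : b ∈ Submodule.span NNReal (Set.range v)) :
    ∃ (t : Finset ι) (r : ι → ℝ), t.card ≤ Module.finrank ℝ F ∧ (∀ i ∈ t, 0 ≤ r i) ∧
      ∑ i ∈ t, r i • v i = b := by
  classical
  have hex : ∃ n, ∃ (t : Finset ι) (r : ι → ℝ), t.card = n ∧ (∀ i ∈ t, 0 ≤ r i) ∧
      ∑ i ∈ t, r i • v i = b := by
    obtain ⟨c, hc⟩ := (Finsupp.mem_span_range_iff_exists_finsupp).1 hb
    exact ⟨_, c.support, fun i => c i, rfl, fun i _ => (c i).2, hc⟩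
  obtain ⟨t, r, hcard, hr, hsum⟩ := Nat.find_spec hex
  refine ⟨t, r, ?_, hr, hsum⟩
  by_contra! hlt
  have hdep : ∃ g : ι → ℝ, ∑ i ∈ t, g i • v i = 0 ∧ ∃ i ∈ t, g i ≠ 0 := by
    by_contra! hind
    have hli : LinearIndepOn ℝ v (t : Set ι) := linearIndepOn_finset_iff.2 fun g hg i hi =>
      hind g hg i hi
    have := LinearIndependent.fintype_card_le_finrank (R := ℝ) hli
    simp at this
    omega
  have hpos : ∃ g : ι → ℝ, ∑ i ∈ t, g i • v i = 0 ∧ ∃ i ∈ t, 0 < g i := by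
    obtain ⟨g, hg, i, hi, hgi⟩ := hdep
    rcases lt_or_gt_of_ne hgi with h | h
    · exact ⟨fun j => -g j, by simp [hg], i, hi, by simpa using h⟩
    · exact ⟨g, hg, i, hi, h⟩
  obtain ⟨g, hg, i₀, hi₀, hgi⟩ := hpos
  obtain ⟨i, hi, r', hr', hsum'⟩ := exists_erase_of_sum_smul_eq hr hg hi₀ hgi
  refine Nat.find_min hex (m := (t.erase i).card) ?_ ⟨_, r', rfl, hr', hsum'.trans hsum⟩
  rw [← hcard, Finset.card_erase_of_mem hi]
  have := Finset.card_pos.2 ⟨i, hi⟩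
  omega

/-! ### Entropy of discrete laws -/

section Entropy

variable {α β : Type*}

/-- The terms of the Shannon entropy of a discrete law. -/
noncomputable def entropyTerm (p : PMF α) (a : α) : ℝ := Real.negMulLog (p a).toReal

theorem toReal_le_one (p : PMF α) (a : α) : (p a).toReal ≤ 1 := by
  simpa using ENNReal.toReal_mono ENNReal.one_ne_top (p.coe_le_one a)

theorem neg_log_toReal_nonneg (p : PMF α) (a : α) : 0 ≤ -Real.log (p a).toReal := by
  have := Real.log_nonpos ENNReal.toReal_nonneg (toReal_le_one p a)
  linarith

theorem entropyTerm_eq (p : PMF α) (a : α) :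
    entropyTerm p a = (p a).toReal * -Real.log (p a).toReal := by
  simp [entropyTerm, Real.negMulLog]

theorem entropyTerm_nonneg (p : PMF α) (a : α) : 0 ≤ entropyTerm p a :=
  Real.negMulLog_nonneg ENNReal.toReal_nonneg (toReal_le_one p a)

theorem entropyTerm_of_notMem (p : PMF α) {a : α} (ha : a ∉ p.support) : entropyTerm p a = 0 := by
  rw [PMF.mem_support_iff, not_not] at ha
  simp [entropyTerm, ha]

theorem summable_entropyTerm_of_finite (p : PMF α) (hp : p.support.Finite) :
    Summable (entropyTerm p) :=
  summable_of_hasFiniteSupport <| hp.subset fun a ha => by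
    by_contra h
    exact ha (entropyTerm_of_notMem p h)

theorem hasSum_toReal_of_tsum_eq {f : α → ENNReal} {c : ENNReal} (hc : c ≠ ⊤)
    (h : ∑' a, f a = c) : HasSum (fun a => (f a).toReal) c.toReal := by
  have hne : ∑' a, f a ≠ ⊤ := h ▸ hc
  rw [← h, ENNReal.tsum_toReal_eq fun a => ENNReal.ne_top_of_tsum_ne_top hne a]
  exact ENNReal.hasSum_toReal hne

theorem hasSum_toReal_pmf (p : PMF α) : HasSum (fun a => (p a).toReal) 1 := by
  simpa using hasSum_toReal_of_tsum_eq ENNReal.one_ne_top p.tsum_coe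

theorem tsum_map_mul (p : PMF α) (f : α → β) (φ : β → ENNReal) :
    ∑' b, p.map f b * φ b = ∑' a, p a * φ (f a) := by
  classical
  simp_rw [PMF.map_apply, ← ENNReal.tsum_mul_right]
  rw [ENNReal.tsum_comm]
  refine tsum_congr fun a => ?_
  rw [tsum_eq_single (f a)]
  · simp
  · intro b hb
    simp [hb]

/-- Transfer of the expectation of a nonnegative function along a map. -/
theorem hasSum_mul_comp (p : PMF α) (f : α → β) {φ : β → ℝ} (hφ : ∀ b, 0 ≤ φ b)
    (hs : Summable fun b => (p.map f b).toReal * φ b) :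
    HasSum (fun a => (p a).toReal * φ (f a)) (∑' b, (p.map f b).toReal * φ b) := by
  have h1 : ∑' b, p.map f b * ENNReal.ofReal (φ b)
      = ENNReal.ofReal (∑' b, (p.map f b).toReal * φ b) := by
    rw [ENNReal.ofReal_tsum_of_nonneg (fun b => mul_nonneg ENNReal.toReal_nonneg (hφ b)) hs]
    refine tsum_congr fun b => ?_
    rw [ENNReal.ofReal_mul ENNReal.toReal_nonneg, ENNReal.ofReal_toReal (PMF.apply_ne_top _ b)]
  have h2 := tsum_map_mul p f fun b => ENNReal.ofReal (φ b)
  rw [h1] at h2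
  have h3 := hasSum_toReal_of_tsum_eq ENNReal.ofReal_ne_top h2.symm
  rw [ENNReal.toReal_ofReal
    (tsum_nonneg fun b => mul_nonneg ENNReal.toReal_nonneg (hφ b))] at h3
  simpa [ENNReal.toReal_mul, ENNReal.toReal_ofReal (hφ _)] using h3

theorem hasSum_mul_neg_log_map (p : PMF α) (f : α → β) (hs : Summable (entropyTerm (p.map f))) :
    HasSum (fun a => (p a).toReal * -Real.log (p.map f (f a)).toReal)
      (∑' b, entropyTerm (p.map f) b) := by
  have := hasSum_mul_comp p f (φ := fun b => -Real.log (p.map f b).toReal)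
    (neg_log_toReal_nonneg _) (by simpa only [← entropyTerm_eq] using hs)
  simpa only [← entropyTerm_eq] using this

theorem apply_le_map_apply (p : PMF α) (f : α → β) (a : α) : p a ≤ p.map f (f a) := by
  classical
  rw [PMF.map_apply]
  refine le_trans ?_ (ENNReal.le_tsum a)
  simp

theorem map_apply_ne_zero (p : PMF α) (f : α → β) {a : α} (ha : p a ≠ 0) : p.map f (f a) ≠ 0 :=
  fun h => ha (le_antisymm (h ▸ apply_le_map_apply p f a) zero_le)

theorem map_apply_of_injOn (p : PMF α) {f : α → β} (hf : Set.InjOn f p.support) {a : α}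
    (ha : a ∈ p.support) : p.map f (f a) = p a := by
  classical
  rw [PMF.map_apply, tsum_eq_single a]
  · simp
  · intro a' ha'
    by_cases h : a' ∈ p.support
    · rw [if_neg fun e => ha' (hf h ha e.symm)]
    · rw [PMF.mem_support_iff, not_not] at h
      simp [h]

/-- Entropy is invariant under maps that are injective on the support. -/
theorem hasSum_entropyTerm_map_iff (p : PMF α) {f : α → β} (hf : Set.InjOn f p.support) {h : ℝ} :
    HasSum (entropyTerm (p.map f)) h ↔ HasSum (entropyTerm p) h := by
  have hsupp : ∀ a : Function.support (entropyTerm p), (a : α) ∈ p.support := fun a => by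
    by_contra hc
    exact a.2 (entropyTerm_of_notMem p hc)
  refine hasSum_iff_hasSum_of_ne_zero_bij (fun a => f a) ?_ ?_ ?_
  · intro a b hab
    exact Subtype.ext (hf (hsupp a) (hsupp b) hab)
  · intro b hb
    have hb' : b ∈ (p.map f).support := by
      by_contra hc
      exact hb (entropyTerm_of_notMem _ hc)
    rw [PMF.mem_support_map_iff] at hb'
    obtain ⟨a, ha, rfl⟩ := hb'
    refine ⟨⟨a, ?_⟩, rfl⟩
    rw [Function.mem_support, entropyTerm, map_apply_of_injOn p hf ha] at hb
    exact hb
  · intro a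
    rw [entropyTerm, map_apply_of_injOn p hf (hsupp a), entropyTerm]

theorem tsum_entropyTerm_map (p : PMF α) {f : α → β} (hf : Set.InjOn f p.support) :
    ∑' b, entropyTerm (p.map f) b = ∑' a, entropyTerm p a := by
  by_cases hs : Summable (entropyTerm p)
  · exact ((hasSum_entropyTerm_map_iff p hf).2 hs.hasSum).tsum_eq
  · rw [tsum_eq_zero_of_not_summable hs, tsum_eq_zero_of_not_summable]
    rintro ⟨h, hh⟩
    exact hs ⟨h, (hasSum_entropyTerm_map_iff p hf).1 hh⟩

theorem summable_entropyTerm_map_iff (p : PMF α) {f : α → β} (hf : Set.InjOn f p.support) :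
    Summable (entropyTerm (p.map f)) ↔ Summable (entropyTerm p) :=
  exists_congr fun _ => hasSum_entropyTerm_map_iff p hf

/-- A fibre weighs at least as much as each of its points. Writing the entropy of the image as a sum
over the source makes the comparison termwise, so that equality of entropies can be read off
pointwise. -/
theorem mul_neg_log_map_le_entropyTerm (p : PMF α) (f : α → β) (a : α) :
    (p a).toReal * -Real.log (p.map f (f a)).toReal ≤ entropyTerm p a := by
  rw [entropyTerm_eq]
  by_cases h : p a = 0
  · simp [h]
  · refine mul_le_mul_of_nonneg_left (neg_le_neg ?_) ENNReal.toReal_nonneg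
    exact Real.log_le_log (ENNReal.toReal_pos h (p.apply_ne_top a))
      (ENNReal.toReal_mono (PMF.apply_ne_top _ _) (apply_le_map_apply p f a))

theorem tsum_entropyTerm_map_le (p : PMF α) (f : α → β) (hp : Summable (entropyTerm p))
    (hm : Summable (entropyTerm (p.map f))) :
    ∑' b, entropyTerm (p.map f) b ≤ ∑' a, entropyTerm p a :=
  hasSum_le (mul_neg_log_map_le_entropyTerm p f) (hasSum_mul_neg_log_map p f hm) hp.hasSum

/-- A map that preserves the entropy is injective on the support. -/
theorem injOn_support_of_tsum_entropyTerm_map_eq (p : PMF α) (f : α → β)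
    (hp : Summable (entropyTerm p)) (hm : Summable (entropyTerm (p.map f)))
    (h : ∑' b, entropyTerm (p.map f) b = ∑' a, entropyTerm p a) : Set.InjOn f p.support := by
  have hD := hp.hasSum.sub (hasSum_mul_neg_log_map p f hm)
  rw [h, sub_self, hasSum_zero_iff_of_nonneg
    (fun a => sub_nonneg.2 (mul_neg_log_map_le_entropyTerm p f a))] at hD
  have hD' : ∀ a ∈ p.support, p.map f (f a) = p a := by
    intro a ha
    have h0 := congrFun hD a
    rw [PMF.mem_support_iff] at ha
    have hpos := ENNReal.toReal_pos ha (p.apply_ne_top a)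
    simp only [Pi.zero_apply, entropyTerm_eq, ← mul_sub, mul_eq_zero, hpos.ne', false_or] at h0
    have h1 : Real.log (p.map f (f a)).toReal = Real.log (p a).toReal := by linarith
    have hpos' := ENNReal.toReal_pos (map_apply_ne_zero p f ha) (PMF.apply_ne_top _ _)
    have h2 := Real.log_injOn_pos hpos' hpos h1
    exact (ENNReal.toReal_eq_toReal_iff' (PMF.apply_ne_top _ _) (p.apply_ne_top a)).1 h2
  intro a ha b hb hab
  by_contra hne
  -- Every support point carries the full mass of its fibre, which leaves no room for a second one.
  classical
  have hle : p a + p b ≤ p.map f (f a) := by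
    rw [PMF.map_apply]
    refine le_trans ?_ (ENNReal.sum_le_tsum {a, b})
    rw [Finset.sum_pair hne]
    simp [hab]
  rw [hD' a ha] at hle
  have hlt : p a < p a + p b := ENNReal.lt_add_right (p.apply_ne_top a) hb
  exact absurd hle (not_le.2 hlt)

/-- This is `log t ≤ t - 1` at `t = q / x`. Summed over a law `x` and a comparison weight `q`, it
yields subadditivity, the bound by the logarithm of the support, and Fano's inequality. -/
theorem gibbs_term {x q : ℝ} (hx : 0 ≤ x) (hq : 0 ≤ q) (h : q = 0 → x = 0) :
    Real.negMulLog x + x * Real.log q ≤ q - x := by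
  rcases hx.eq_or_lt with rfl | hx
  · simpa using hq
  have hq' : 0 < q := hq.lt_of_ne fun h0 => hx.ne' (h h0.symm)
  have := Real.log_le_sub_one_of_pos (div_pos hq' hx)
  rw [Real.log_div hq'.ne' hx.ne'] at this
  have h2 := mul_le_mul_of_nonneg_left this hx.le
  have h3 : x * (q / x - 1) = q - x := by field_simp
  rw [h3] at h2
  simp only [Real.negMulLog]
  linarith

theorem eq_of_gibbs_term_eq {x q : ℝ} (hx : 0 ≤ x) (hq : 0 ≤ q) (h : q = 0 → x = 0)
    (heq : Real.negMulLog x + x * Real.log q = q - x) : x = q := by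
  rcases hx.eq_or_lt with rfl | hx
  · simpa using heq
  have hq' : 0 < q := hq.lt_of_ne fun h0 => hx.ne' (h h0.symm)
  by_contra hne
  have hne' : q / x ≠ 1 := fun h1 => hne (by rw [div_eq_one_iff_eq hx.ne'] at h1; exact h1.symm)
  have := Real.log_lt_sub_one_of_pos (div_pos hq' hx) hne'
  rw [Real.log_div hq'.ne' hx.ne'] at this
  have h2 := mul_lt_mul_of_pos_left this hx
  have h3 : x * (q / x - 1) = q - x := by field_simp
  rw [h3] at h2
  simp only [Real.negMulLog] at heq
  linarith

/-- Independence of the two components of a discrete law on a product. -/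
def IsProd (p : PMF (α × β)) : Prop :=
  ∀ z, p z = p.map Prod.fst z.1 * p.map Prod.snd z.2

theorem tsum_fst_mul_snd (a : PMF α) (b : PMF β) : ∑' z : α × β, a z.1 * b z.2 = 1 := by
  rw [ENNReal.tsum_prod']
  simp [ENNReal.tsum_mul_left, PMF.tsum_coe]

theorem hasSum_fst_mul_snd (a : PMF α) (b : PMF β) :
    HasSum (fun z : α × β => (a z.1).toReal * (b z.2).toReal) 1 := by
  simpa [ENNReal.toReal_mul] using
    hasSum_toReal_of_tsum_eq ENNReal.one_ne_top (tsum_fst_mul_snd a b)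

theorem entropyTerm_add_mul_log (p : PMF (α × β)) (z : α × β) :
    entropyTerm p z - (p z).toReal * -Real.log (p.map Prod.fst z.1).toReal
        - (p z).toReal * -Real.log (p.map Prod.snd z.2).toReal =
      Real.negMulLog (p z).toReal + (p z).toReal *
        Real.log ((p.map Prod.fst z.1).toReal * (p.map Prod.snd z.2).toReal) := by
  by_cases h : p z = 0
  · simp [h, entropyTerm]
  · have h1 := ENNReal.toReal_pos (map_apply_ne_zero p Prod.fst h) (PMF.apply_ne_top _ _)
    have h2 := ENNReal.toReal_pos (map_apply_ne_zero p Prod.snd h) (PMF.apply_ne_top _ _)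
    rw [Real.log_mul h1.ne' h2.ne', entropyTerm]
    ring

section Joint

variable (p : PMF (α × β)) (hp : Summable (entropyTerm p))
  (h1 : Summable (entropyTerm (p.map Prod.fst))) (h2 : Summable (entropyTerm (p.map Prod.snd)))
include hp h1 h2

theorem hasSum_gibbs_prod :
    HasSum (fun z => Real.negMulLog (p z).toReal + (p z).toReal *
        Real.log ((p.map Prod.fst z.1).toReal * (p.map Prod.snd z.2).toReal))
      (∑' z, entropyTerm p z - ∑' a, entropyTerm (p.map Prod.fst) a
        - ∑' b, entropyTerm (p.map Prod.snd) b) := by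
  simp_rw [← entropyTerm_add_mul_log]
  exact (hp.hasSum.sub (hasSum_mul_neg_log_map p Prod.fst h1)).sub
    (hasSum_mul_neg_log_map p Prod.snd h2)

omit hp h1 h2 in
theorem gibbs_prod_cond (z : α × β)
    (hz : (p.map Prod.fst z.1).toReal * (p.map Prod.snd z.2).toReal = 0) : (p z).toReal = 0 := by
  by_contra h
  have h' : p z ≠ 0 := fun h0 => h (by simp [h0])
  have h1 := ENNReal.toReal_pos (map_apply_ne_zero p Prod.fst h') (PMF.apply_ne_top _ _)
  have h2 := ENNReal.toReal_pos (map_apply_ne_zero p Prod.snd h') (PMF.apply_ne_top _ _)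
  exact (mul_pos h1 h2).ne' hz

theorem tsum_entropyTerm_le_add :
    ∑' z, entropyTerm p z ≤
      ∑' a, entropyTerm (p.map Prod.fst) a + ∑' b, entropyTerm (p.map Prod.snd) b := by
  have hle := hasSum_le (fun z => gibbs_term ENNReal.toReal_nonneg
    (mul_nonneg ENNReal.toReal_nonneg ENNReal.toReal_nonneg) (gibbs_prod_cond p z))
    (hasSum_gibbs_prod p hp h1 h2) ((hasSum_fst_mul_snd _ _).sub (hasSum_toReal_pmf p))
  linarith

/-- Equality of the sums in Gibbs' inequality forces equality in every term, hence the law equals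
the product of its marginals pointwise. -/
theorem isProd_of_tsum_entropyTerm_eq
    (h : ∑' z, entropyTerm p z =
      ∑' a, entropyTerm (p.map Prod.fst) a + ∑' b, entropyTerm (p.map Prod.snd) b) :
    IsProd p := by
  have hD := ((hasSum_fst_mul_snd (p.map Prod.fst) (p.map Prod.snd)).sub
    (hasSum_toReal_pmf p)).sub (hasSum_gibbs_prod p hp h1 h2)
  rw [h, show (1 - 1 : ℝ) - (∑' a, entropyTerm (p.map Prod.fst) a +
    ∑' b, entropyTerm (p.map Prod.snd) b - ∑' a, entropyTerm (p.map Prod.fst) a -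
    ∑' b, entropyTerm (p.map Prod.snd) b) = 0 by ring, hasSum_zero_iff_of_nonneg
    (fun z => sub_nonneg.2 (gibbs_term ENNReal.toReal_nonneg
      (mul_nonneg ENNReal.toReal_nonneg ENNReal.toReal_nonneg) (gibbs_prod_cond p z)))] at hD
  intro z
  have hz := eq_of_gibbs_term_eq ENNReal.toReal_nonneg
    (mul_nonneg ENNReal.toReal_nonneg ENNReal.toReal_nonneg) (gibbs_prod_cond p z)
    (sub_eq_zero.1 (congrFun hD z)).symm
  rw [← ENNReal.toReal_mul] at hz
  exact (ENNReal.toReal_eq_toReal_iff' (p.apply_ne_top z)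
    (ENNReal.mul_ne_top (PMF.apply_ne_top _ _) (PMF.apply_ne_top _ _))).1 hz

theorem tsum_entropyTerm_eq_of_isProd (h : IsProd p) :
    ∑' z, entropyTerm p z =
      ∑' a, entropyTerm (p.map Prod.fst) a + ∑' b, entropyTerm (p.map Prod.snd) b := by
  have hs := hasSum_gibbs_prod p hp h1 h2
  have h0 : (fun z => Real.negMulLog (p z).toReal + (p z).toReal *
        Real.log ((p.map Prod.fst z.1).toReal * (p.map Prod.snd z.2).toReal)) = 0 := by
    funext z
    rw [← ENNReal.toReal_mul, ← h z]
    simp [Real.negMulLog]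
  rw [h0] at hs
  have := hs.unique hasSum_zero
  linarith

end Joint

/-- The factors need not be normalised, since their total masses multiply to 1. Reweighted product
laws arise in this form. -/
theorem isProd_of_eq_mul (p : PMF (α × β)) (f : α → ENNReal) (g : β → ENNReal)
    (h : ∀ z, p z = f z.1 * g z.2) : IsProd p := by
  classical
  have hsum : (∑' a, f a) * ∑' b, g b = 1 := by
    rw [← p.tsum_coe, ENNReal.tsum_prod', ← ENNReal.tsum_mul_right]
    simp_rw [h, ENNReal.tsum_mul_left]
  have h1 : ∀ a, p.map Prod.fst a = f a * ∑' b, g b := by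
    intro a
    rw [PMF.map_apply, ENNReal.tsum_prod', tsum_eq_single a]
    · simp [h, ENNReal.tsum_mul_left]
    · intro a' ha'
      simp [ha'.symm]
  have h2 : ∀ b, p.map Prod.snd b = (∑' a, f a) * g b := by
    intro b
    rw [PMF.map_apply, ENNReal.tsum_prod', ← ENNReal.tsum_mul_right]
    refine tsum_congr fun a => ?_
    rw [tsum_eq_single b]
    · simp [h]
    · intro b' hb'
      simp [hb'.symm]
  intro z
  rw [h, h1, h2, mul_assoc, ← mul_assoc (∑' b, g b), mul_comm (∑' b, g b), hsum, one_mul]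

/-! ### Laws with finite support -/

theorem tsum_eq_sum_support (p : PMF α) (hp : p.support.Finite) {φ : α → ℝ}
    (hφ : ∀ a ∉ p.support, φ a = 0) : ∑' a, φ a = ∑ a ∈ hp.toFinset, φ a :=
  tsum_eq_sum fun a ha => hφ a (by simpa using ha)

theorem sum_toReal_eq_one (p : PMF α) {F : Finset α} (hF : p.support ⊆ F) :
    ∑ a ∈ F, (p a).toReal = 1 := by
  rw [← (hasSum_toReal_pmf p).tsum_eq, tsum_eq_sum]
  intro a ha
  have : p a = 0 := by
    by_contra h
    exact ha (hF h)
  simp [this]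

theorem ncard_support_pos (p : PMF α) (hp : p.support.Finite) : 0 < p.support.ncard :=
  (Set.ncard_pos hp).2 p.support_nonempty

theorem tsum_entropyTerm_le_log (p : PMF α) (hp : p.support.Finite) :
    ∑' a, entropyTerm p a ≤ Real.log p.support.ncard := by
  have hm : (0 : ℝ) < p.support.ncard := by exact_mod_cast ncard_support_pos p hp
  rw [tsum_eq_sum_support p hp fun a ha => entropyTerm_of_notMem p ha]
  have hone := sum_toReal_eq_one p (F := hp.toFinset) (by simp)
  have hle : ∑ a ∈ hp.toFinset, (entropyTerm p a +
      (p a).toReal * Real.log ((p.support.ncard : ℝ)⁻¹)) ≤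
      ∑ a ∈ hp.toFinset, ((p.support.ncard : ℝ)⁻¹ - (p a).toReal) :=
    Finset.sum_le_sum fun a _ => gibbs_term ENNReal.toReal_nonneg (by positivity)
      (fun h => absurd h (by positivity))
  rw [Finset.sum_add_distrib, ← Finset.sum_mul, hone, Finset.sum_sub_distrib, hone,
    Finset.sum_const, ← Set.ncard_eq_toFinset_card _ hp, nsmul_eq_mul,
    mul_inv_cancel₀ hm.ne', Real.log_inv] at hle
  linarith

theorem finite_support_of_uniform (p : PMF α)
    (h : ∀ a ∈ p.support, ∀ b ∈ p.support, p a = p b) : p.support.Finite := by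
  obtain ⟨a, ha⟩ := p.support_nonempty
  refine (ENNReal.finite_const_le_of_tsum_ne_top (a := p) (ε := p a) (by simp [p.tsum_coe])
    ha).subset fun b hb => ?_
  exact (h a ha b hb).le

theorem tsum_entropyTerm_of_uniform (p : PMF α)
    (h : ∀ a ∈ p.support, ∀ b ∈ p.support, p a = p b) :
    ∑' a, entropyTerm p a = Real.log p.support.ncard := by
  have hp := finite_support_of_uniform p h
  have hm : (0 : ℝ) < p.support.ncard := by exact_mod_cast ncard_support_pos p hp
  obtain ⟨a, ha⟩ := p.support_nonempty
  have hconst : ∀ b ∈ hp.toFinset, p b = p a := fun b hb => h b (by simpa using hb) a ha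
  have hone := sum_toReal_eq_one p (F := hp.toFinset) (by simp)
  rw [Finset.sum_congr rfl fun b hb => by rw [hconst b hb], Finset.sum_const,
    ← Set.ncard_eq_toFinset_card _ hp, nsmul_eq_mul] at hone
  rw [tsum_eq_sum_support p hp fun a ha => entropyTerm_of_notMem p ha,
    Finset.sum_congr rfl fun b hb => by rw [entropyTerm_eq, hconst b hb], Finset.sum_const,
    ← Set.ncard_eq_toFinset_card _ hp, nsmul_eq_mul, ← mul_assoc, hone,
    eq_inv_of_mul_eq_one_right hone, Real.log_inv]
  ring

end Entropy

/-! ### Fano's inequality -/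

section Fano

variable {α β : Type*}

/-- Fano's inequality. -/
theorem tsum_entropyTerm_sub_le_binEntropy (p : PMF (α × β)) (hp : p.support.Finite) (g : β → α) :
    ∑' z, entropyTerm p z - ∑' b, entropyTerm (p.map Prod.snd) b ≤
      Real.binEntropy (p.toOuterMeasure {z | z.1 ≠ g z.2}).toReal +
        (p.toOuterMeasure {z | z.1 ≠ g z.2}).toReal *
          Real.log (p.map Prod.fst).support.ncard := by
  classical
  set e := (p.toOuterMeasure {z | z.1 ≠ g z.2}).toReal with he
  set m : ℝ := ((p.map Prod.fst).support.ncard : ℝ) with hm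
  have hfin1 : (p.map Prod.fst).support.Finite := by
    rw [PMF.support_map]; exact hp.image _
  have hfin2 : (p.map Prod.snd).support.Finite := by
    rw [PMF.support_map]; exact hp.image _
  have hm0 : 0 < m := by rw [hm]; exact_mod_cast ncard_support_pos _ hfin1
  set F : Finset (α × β) := hfin1.toFinset ×ˢ hfin2.toFinset with hF
  have hpF : p.support ⊆ F := by
    intro z hz
    simp only [hF, Finset.coe_product, Set.Finite.coe_toFinset, Set.mem_prod, PMF.support_map]
    exact ⟨⟨z, hz, rfl⟩, ⟨z, hz, rfl⟩⟩
  have hsumF : ∀ φ : α × β → ℝ, (∀ z, p z = 0 → φ z = 0) → ∑' z, φ z = ∑ z ∈ F, φ z := by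
    intro φ hφ
    refine tsum_eq_sum fun z hz => hφ z ?_
    by_contra h
    exact hz (hpF h)
  have hone := sum_toReal_eq_one p hpF
  have heF : ∑ z ∈ F, (if z.1 = g z.2 then 0 else (p z).toReal) = e := by
    rw [← hsumF _ (by intro z hz; simp [hz]), he, PMF.toOuterMeasure_apply,
      ENNReal.tsum_toReal_eq]
    · refine tsum_congr fun z => ?_
      by_cases h : z.1 = g z.2 <;> simp [h]
    · intro z
      exact ne_top_of_le_ne_top (p.apply_ne_top z) (Set.indicator_le_self _ _ z)
  have heF' : ∑ z ∈ F, (if z.1 = g z.2 then (p z).toReal else 0) = 1 - e := by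
    rw [← hone, ← heF, ← Finset.sum_sub_distrib]
    refine Finset.sum_congr rfl fun z _ => ?_
    split_ifs <;> simp
  have he0 : 0 ≤ e := ENNReal.toReal_nonneg
  have he1 : 0 ≤ 1 - e := by
    rw [← heF']
    exact Finset.sum_nonneg fun z _ => by split_ifs <;> simp
  set b : β → ℝ := fun y => (p.map Prod.snd y).toReal with hb
  -- The comparison weight `b z.2 * k z` models a guess that is right with probability `1 - e` and
  -- spreads the error evenly over `m` values. Its total mass is at most 1, which suffices for
  -- Gibbs' inequality.
  set k : α × β → ℝ := fun z => if z.1 = g z.2 then 1 - e else e / m with hk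
  have hk0 : ∀ z, 0 ≤ k z := by
    intro z
    simp only [hk]
    split_ifs
    · exact he1
    · positivity
  have hbpos : ∀ z, p z ≠ 0 → 0 < b z.2 := fun z hz =>
    ENNReal.toReal_pos (map_apply_ne_zero p Prod.snd hz) (PMF.apply_ne_top _ _)
  have hkpos : ∀ z, p z ≠ 0 → 0 < k z := by
    intro z hz
    have hzF : z ∈ F := hpF hz
    have hz0 := ENNReal.toReal_pos hz (p.apply_ne_top z)
    simp only [hk]
    split_ifs with h
    · rw [← heF']
      refine lt_of_lt_of_le hz0 (le_trans ?_ (Finset.single_le_sum (f := fun z : α × β =>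
        if z.1 = g z.2 then (p z).toReal else 0) (fun z _ => by split_ifs <;> simp)
        hzF))
      simp [h]
    · refine div_pos ?_ hm0
      rw [← heF]
      refine lt_of_lt_of_le hz0 (le_trans ?_ (Finset.single_le_sum (f := fun z : α × β =>
        if z.1 = g z.2 then 0 else (p z).toReal) (fun z _ => by split_ifs <;> simp)
        hzF))
      simp [h]
  have hgibbs : ∑ z ∈ F, (entropyTerm p z + (p z).toReal * Real.log (b z.2 * k z)) ≤
      ∑ z ∈ F, (b z.2 * k z - (p z).toReal) := by
    refine Finset.sum_le_sum fun z _ => gibbs_term ENNReal.toReal_nonneg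
      (mul_nonneg ENNReal.toReal_nonneg (hk0 z)) fun h => ?_
    by_contra hz
    have hz' : p z ≠ 0 := fun h0 => hz (by simp [h0])
    exact (mul_pos (hbpos z hz') (hkpos z hz')).ne' h
  have hq : ∑ z ∈ F, b z.2 * k z ≤ 1 := by
    rw [hF, Finset.sum_product_right]
    have hin : ∀ y, ∑ x ∈ hfin1.toFinset, b y * k (x, y) ≤ b y := by
      intro y
      rw [← Finset.mul_sum]
      refine mul_le_of_le_one_right ENNReal.toReal_nonneg ?_
      calc ∑ x ∈ hfin1.toFinset, k (x, y)
          ≤ ∑ x ∈ hfin1.toFinset, ((if x = g y then 1 - e else 0) + e / m) := by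
            refine Finset.sum_le_sum fun x _ => ?_
            simp only [hk]
            split_ifs
            · have : 0 ≤ e / m := by positivity
              linarith
            · simp
        _ ≤ (1 - e) + e := by
            rw [Finset.sum_add_distrib, Finset.sum_const, ← Set.ncard_eq_toFinset_card _ hfin1,
              nsmul_eq_mul, ← hm, mul_div_cancel₀ _ hm0.ne', Finset.sum_ite_eq']
            gcongr
            split_ifs
            · exact le_rfl
            · exact he1
        _ = 1 := by ring
    refine (Finset.sum_le_sum fun y _ => hin y).trans ?_
    exact (sum_toReal_eq_one (p.map Prod.snd) (F := hfin2.toFinset) (by simp)).le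
  have hlog : ∀ z, (p z).toReal * Real.log (b z.2 * k z) =
      -((p z).toReal * -Real.log (b z.2)) +
        ((if z.1 = g z.2 then (p z).toReal else 0) * Real.log (1 - e) +
          (if z.1 = g z.2 then 0 else (p z).toReal) * (Real.log e - Real.log m)) := by
    intro z
    by_cases hz : p z = 0
    · simp [hz]
    · have h1 := hbpos z hz
      have h2 := hkpos z hz
      rw [Real.log_mul h1.ne' h2.ne']
      simp only [hk] at h2 ⊢
      split_ifs with h
      · ring
      · rw [if_neg h] at h2
        have he' : e ≠ 0 := by
          rintro h0
          simp [h0] at h2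
        rw [Real.log_div he' hm0.ne']
        ring
  have hsnd : ∑ z ∈ F, (p z).toReal * -Real.log (b z.2) =
      ∑' y, entropyTerm (p.map Prod.snd) y := by
    rw [← (hasSum_mul_neg_log_map p Prod.snd
      (summable_entropyTerm_of_finite _ hfin2)).tsum_eq, hsumF]
    intro z hz
    simp [hz]
  simp_rw [hlog] at hgibbs
  rw [Finset.sum_add_distrib, Finset.sum_add_distrib, Finset.sum_add_distrib,
    Finset.sum_neg_distrib, ← Finset.sum_mul, ← Finset.sum_mul, heF, heF', hsnd,
    Finset.sum_sub_distrib, hone, ← hsumF _ fun z hz => by simp [entropyTerm, hz]] at hgibbs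
  rw [Real.binEntropy, Real.log_inv, Real.log_inv]
  linarith

/-- A form of Fano's inequality that is proportional to the logarithm of the number of values
of the estimated variable. -/
theorem tsum_entropyTerm_sub_le_mul_log (p : PMF (α × β)) (hp : p.support.Finite) (g : β → α) :
    ∑' z, entropyTerm p z - ∑' b, entropyTerm (p.map Prod.snd) b ≤
      (Real.binEntropy (p.toOuterMeasure {z | z.1 ≠ g z.2}).toReal / Real.log 2 +
        (p.toOuterMeasure {z | z.1 ≠ g z.2}).toReal) *
          Real.log (p.map Prod.fst).support.ncard := by
  have hfin1 : (p.map Prod.fst).support.Finite := by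
    rw [PMF.support_map]; exact hp.image _
  have hpos := ncard_support_pos _ hfin1
  have hl2 : 0 < Real.log 2 := Real.log_pos one_lt_two
  -- Nothing bounds the scaling `c n` when the source is constant, so the additive term of Fano's
  -- inequality must be absorbed. With two or more values, `log 2` is at most the logarithm on the
  -- right; with a single value the left side is 0.
  rcases Nat.lt_or_ge 1 (p.map Prod.fst).support.ncard with h | h
  · refine (tsum_entropyTerm_sub_le_binEntropy p hp g).trans ?_
    rw [add_mul]
    gcongr
    have hle : (p.toOuterMeasure {z | z.1 ≠ g z.2}).toReal ≤ 1 := by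
      refine ENNReal.toReal_mono (b := 1) ENNReal.one_ne_top ?_
      rw [PMF.toOuterMeasure_apply, ← p.tsum_coe]
      exact ENNReal.tsum_le_tsum fun z => Set.indicator_le_self _ _ z
    have hb := Real.binEntropy_nonneg ENNReal.toReal_nonneg hle
    have hlog : Real.log 2 ≤ Real.log (p.map Prod.fst).support.ncard :=
      Real.log_le_log two_pos (by exact_mod_cast h)
    rw [div_mul_eq_mul_div, le_div_iff₀ hl2]
    exact mul_le_mul_of_nonneg_left hlog hb
  · have h1 : (p.map Prod.fst).support.ncard = 1 := le_antisymm h hpos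
    obtain ⟨a, ha⟩ := Set.ncard_eq_one.1 h1
    have hinj : Set.InjOn (Prod.snd : α × β → β) p.support := by
      intro x hx y hy hxy
      have hmem : ∀ z ∈ p.support, z.1 = a := fun z hz => by
        have : z.1 ∈ (p.map Prod.fst).support := by
          rw [PMF.support_map]; exact ⟨z, hz, rfl⟩
        rwa [ha] at this
      exact Prod.ext ((hmem x hx).trans (hmem y hy).symm) hxy
    rw [tsum_entropyTerm_map p hinj, h1]
    simp

end Fano

/-! ### Reweighting -/

section Reweight

variable {Ω X κ : Type*}

/-- The law with density `w` with respect to `μ`. -/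
noncomputable def reweight (μ : PMF Ω) (w : Ω → ENNReal) (h : ∑' y, μ y * w y = 1) : PMF Ω :=
  ⟨fun y => μ y * w y, h ▸ ENNReal.summable.hasSum⟩

theorem reweight_apply (μ : PMF Ω) (w : Ω → ENNReal) (h : ∑' y, μ y * w y = 1) (y : Ω) :
    reweight μ w h y = μ y * w y := rfl

theorem map_reweight (μ : PMF Ω) (w : Ω → ENNReal) (h : ∑' y, μ y * w y = 1) (f : Ω → X)
    (r : X → ENNReal) (hr : ∀ y, w y = r (f y)) (x : X) :
    (reweight μ w h).map f x = μ.map f x * r x := by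
  classical
  rw [PMF.map_apply, PMF.map_apply, ← ENNReal.tsum_mul_right]
  refine tsum_congr fun y => ?_
  split_ifs with hy
  · rw [reweight_apply, hr, hy]
  · simp

theorem support_reweight_subset (μ : PMF Ω) (w : Ω → ENNReal) (h : ∑' y, μ y * w y = 1) :
    (reweight μ w h).support ⊆ μ.support := fun _ hy => left_ne_zero_of_mul hy

theorem map_fst_apply (p : PMF (X × κ)) (x : X) : p.map Prod.fst x = ∑' k, p (x, k) := by
  classical
  rw [PMF.map_apply, ENNReal.tsum_prod', tsum_eq_single x]
  · simp
  · intro x' hx'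
    simp [hx'.symm]

/-- The conditional laws of a finitely supported variable can be mixed with finitely many weights
so as to give its law. -/
theorem exists_reweight (p : PMF (X × κ)) (hp : (p.map Prod.fst).support.Finite) :
    ∃ r : κ → ENNReal, (Function.support r).Finite ∧
      (Function.support r).ncard ≤ (p.map Prod.fst).support.ncard ∧
      ∀ x, ∑' k, p (x, k) * r k = p.map Prod.fst x := by
  classical
  have : Fintype (p.map Prod.fst).support := hp.fintype
  -- Restricting to the support makes the dimension, and so the number of weights, the number of
  -- values of the first variable.
  let v : κ → (p.map Prod.fst).support → ℝ := fun k x => (p (x, k)).toReal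
  let b : (p.map Prod.fst).support → ℝ := fun x => (p.map Prod.fst x).toReal
  have hsum : HasSum v b := Pi.hasSum.2 fun x =>
    hasSum_toReal_of_tsum_eq (PMF.apply_ne_top _ _) (map_fst_apply p x).symm
  obtain ⟨t, r, hcard, hr, hb⟩ :=
    exists_finset_card_le_of_mem_span_nnreal (mem_span_nnreal_of_hasSum hsum)
  rw [Module.finrank_fintype_fun_eq_card, ← Nat.card_eq_fintype_card, Nat.card_coe_set_eq] at hcard
  let r' : κ → ENNReal := fun k => if k ∈ t then ENNReal.ofReal (r k) else 0
  have hsub : Function.support r' ⊆ t := by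
    intro k hk
    by_contra h
    exact hk (if_neg h)
  refine ⟨r', t.finite_toSet.subset hsub, ?_, fun x => ?_⟩
  · refine (Set.ncard_le_ncard hsub t.finite_toSet).trans ?_
    rwa [Set.ncard_coe_finset]
  · rw [tsum_eq_sum (s := t) fun k hk => by simp [r', hk]]
    by_cases hx : x ∈ (p.map Prod.fst).support
    · have hx' := congrFun hb ⟨x, hx⟩
      simp only [Finset.sum_apply, Pi.smul_apply, smul_eq_mul, v, b] at hx'
      rw [← ENNReal.ofReal_toReal (PMF.apply_ne_top (p.map Prod.fst) x), ← hx',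
        ENNReal.ofReal_sum_of_nonneg fun k hk => mul_nonneg (hr k hk) ENNReal.toReal_nonneg]
      refine Finset.sum_congr rfl fun k hk => ?_
      rw [ENNReal.ofReal_mul (hr k hk), ENNReal.ofReal_toReal (p.apply_ne_top _)]
      simp [r', hk, mul_comm]
    · rw [PMF.mem_support_iff, not_not] at hx
      have h0 : ∀ k, p (x, k) = 0 := by
        rw [map_fst_apply, ENNReal.tsum_eq_zero] at hx
        exact hx
      simp [hx, h0]

end Reweight

/-! ### Reduction of the keys -/

section Keys

variable {I : Type*} {A : I → Type}

/-- Under the law `μ`, coordinate `i` is independent of the other coordinates in `T`. -/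
def IndepCoord (μ : PMF (∀ i, A i)) (T : Set I) (i : I) : Prop :=
  IsProd (μ.map fun y => (y i, fun j : ↥(T \ {i}) => y j))

/-- The number of values of an independent coordinate can be reduced to the number of values of
the coordinates in `B`, without changing the law of these. -/
theorem exists_reduce_coord (μ : PMF (∀ i, A i)) (B T : Set I) {u : I} (hu : u ∈ T)
    (hB : (μ.map fun y (j : B) => y j).support.Finite) :
    ∃ μ' : PMF (∀ i, A i), μ'.support ⊆ μ.support ∧
      (μ'.map fun y (j : B) => y j) = (μ.map fun y (j : B) => y j) ∧
      (∀ i ∈ T, IndepCoord μ T i → IndepCoord μ' T i) ∧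
      (μ'.map fun y => y u).support.Finite ∧
      (μ'.map fun y => y u).support.ncard ≤ (μ.map fun y (j : B) => y j).support.ncard := by
  classical
  set f : (∀ i, A i) → (∀ j : B, A j) := fun y j => y j with hf
  set p : PMF ((∀ j : B, A j) × A u) := μ.map fun y => (f y, y u) with hp
  have hp1 : p.map Prod.fst = μ.map f := by rw [hp, PMF.map_comp]; rfl
  obtain ⟨r, hrfin, hrcard, hr⟩ := exists_reweight p (by rwa [hp1])
  -- The total mass is that of the law of the coordinates in `B`, which the mixture reproduces.
  have hone : ∑' y, μ y * r (y u) = 1 := by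
    rw [← tsum_map_mul μ (fun y => (f y, y u)) (fun z => r z.2), ENNReal.tsum_prod']
    simp_rw [← hp, hr, PMF.tsum_coe]
  have hsupp : (((reweight μ (fun y => r (y u)) hone)).map fun y => y u).support ⊆
      Function.support r := by
    intro a ha
    rw [PMF.mem_support_iff, map_reweight μ _ hone (fun y => y u) r fun _ => rfl] at ha
    exact right_ne_zero_of_mul ha
  refine ⟨reweight μ (fun y => r (y u)) hone, support_reweight_subset _ _ _, ?_, ?_,
    hrfin.subset hsupp, (Set.ncard_le_ncard hsupp hrfin).trans (hp1 ▸ hrcard)⟩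
  · have h1 : (reweight μ (fun y => r (y u)) hone).map f =
        ((reweight μ (fun y => r (y u)) hone).map fun y => (f y, y u)).map Prod.fst := by
      rw [PMF.map_comp]; rfl
    ext x
    rw [h1, map_fst_apply]
    simp_rw [map_reweight μ _ hone (fun y => (f y, y u)) (fun z => r z.2) fun _ => rfl]
    rw [← hp, hr, hp1]
  · intro i hi hind
    -- The density depends on coordinate `u` alone, so it is absorbed by the factor of `i` if `i =
    -- u` and by the factor of the other coordinates otherwise.
    by_cases hiu : i = u
    · subst hiu
      refine isProd_of_eq_mul _ (fun a => (μ.map (fun y =>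
        (y i, fun j : ↥(T \ {i}) => y j))).map Prod.fst a * r a)
        ((μ.map (fun y => (y i, fun j : ↥(T \ {i}) => y j))).map Prod.snd) fun z => ?_
      rw [map_reweight μ _ hone _ (fun z => r z.1) fun _ => rfl, hind z]
      ring
    · refine isProd_of_eq_mul _ ((μ.map (fun y =>
        (y i, fun j : ↥(T \ {i}) => y j))).map Prod.fst)
        (fun c => (μ.map (fun y => (y i, fun j : ↥(T \ {i}) => y j))).map Prod.snd c *
          r (c ⟨u, hu, fun h => hiu h.symm⟩)) fun z => ?_
      rw [map_reweight μ _ hone _ (fun z => r (z.2 ⟨u, hu, fun h => hiu h.symm⟩)) fun _ => rfl,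
        hind z]
      ring

theorem support_map_mono {Ω β : Type*} {μ ν : PMF Ω} (h : μ.support ⊆ ν.support) (f : Ω → β) :
    (μ.map f).support ⊆ (ν.map f).support := by
  rw [PMF.support_map, PMF.support_map]
  exact Set.image_mono h

/-- The coordinates are treated one at a time. Earlier bounds survive because supports only shrink,
and the bound itself is fixed because the law on `B` never changes. -/
theorem exists_reduce_coords (μ : PMF (∀ i, A i)) (B T : Set I) (U : Finset I)
    (hU : (U : Set I) ⊆ T) (hB : (μ.map fun y (j : B) => y j).support.Finite) :
    ∃ μ' : PMF (∀ i, A i), μ'.support ⊆ μ.support ∧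
      (μ'.map fun y (j : B) => y j) = (μ.map fun y (j : B) => y j) ∧
      (∀ i ∈ T, IndepCoord μ T i → IndepCoord μ' T i) ∧
      ∀ u ∈ U, (μ'.map fun y => y u).support.Finite ∧
        (μ'.map fun y => y u).support.ncard ≤ (μ.map fun y (j : B) => y j).support.ncard := by
  classical
  induction U using Finset.induction_on with
  | empty => exact ⟨μ, subset_rfl, rfl, fun _ _ h => h, by simp⟩
  | insert u U _ ih =>
    rw [Finset.coe_insert, Set.insert_subset_iff] at hU
    obtain ⟨μ₁, hs₁, hB₁, hi₁, hu₁⟩ := ih hU.2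
    obtain ⟨μ₂, hs₂, hB₂, hi₂, hf₂, hc₂⟩ := exists_reduce_coord μ₁ B T hU.1 (by rwa [hB₁])
    refine ⟨μ₂, hs₂.trans hs₁, hB₂.trans hB₁, fun i hi h => hi₂ i hi (hi₁ i hi h), ?_⟩
    intro w hw
    rw [Finset.mem_insert] at hw
    rcases hw with rfl | hw
    · exact ⟨hf₂, by rwa [hB₁] at hc₂⟩
    · have hsub := support_map_mono hs₂ fun y => y w
      exact ⟨(hu₁ w hw).1.subset hsub, (Set.ncard_le_ncard hsub (hu₁ w hw).1).trans (hu₁ w hw).2⟩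

end Keys

/-! ### Entropy functions of families of random variables -/

section Support

variable {ι : Type*} {A : ι → Type*} [Fintype ι] (μ : PMF (∀ i, A i))
  (h : ∀ i, (μ.map fun y => y i).support.Finite)
include h

theorem support_subset_piFinset [DecidableEq ι] :
    μ.support ⊆ (Fintype.piFinset fun i => (h i).toFinset : Finset (∀ i, A i)) := by
  intro y hy
  simp only [Finset.mem_coe, Fintype.mem_piFinset, Set.Finite.mem_toFinset]
  exact fun i => map_apply_ne_zero μ (fun y => y i) hy

theorem finite_support_of_forall_coord : μ.support.Finite := by
  classical
  exact (Finset.finite_toSet _).subset (support_subset_piFinset μ h)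

theorem log_ncard_support_le_sum :
    Real.log μ.support.ncard ≤ ∑ i, Real.log (μ.map fun y => y i).support.ncard := by
  classical
  have hle : μ.support.ncard ≤ ∏ i, (μ.map fun y => y i).support.ncard := by
    refine (Set.ncard_le_ncard (support_subset_piFinset μ h) (Finset.finite_toSet _)).trans ?_
    rw [Set.ncard_coe_finset, Fintype.card_piFinset]
    exact Finset.prod_le_prod' fun i _ => (Set.ncard_eq_toFinset_card _ (h i)).ge
  rw [← Real.log_prod fun i _ => by exact_mod_cast (ncard_support_pos _ (h i)).ne']
  refine Real.log_le_log ?_ (by exact_mod_cast hle)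
  exact_mod_cast ncard_support_pos _ (finite_support_of_forall_coord μ h)

end Support

theorem IsProd.map_snd {α β γ : Type*} {p : PMF (α × β)} (hp : IsProd p) (ρ : β → γ) :
    IsProd (p.map (Prod.map id ρ)) := by
  classical
  refine isProd_of_eq_mul _ (p.map Prod.fst) ((p.map Prod.snd).map ρ) fun z => ?_
  rw [PMF.map_apply, PMF.map_apply _ (p.map Prod.snd), ENNReal.tsum_prod', tsum_eq_single z.1,
    ← ENNReal.tsum_mul_left]
  · refine tsum_congr fun b => ?_
    simp only [Prod.map_apply, id_eq, Prod.ext_iff, true_and]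
    split_ifs
    · exact hp (z.1, b)
    · simp
  · intro a ha
    simp [Prod.ext_iff, ha.symm]

namespace RandomVars

variable {N : Type*} (Y : RandomVars N)

theorem entropy_nonneg (A : Set N) : 0 ≤ Y.entropy A := tsum_nonneg (entropyTerm_nonneg _)

theorem marginal_eq_map_of_subset {A C : Set N} (h : C ⊆ A) :
    Y.marginal C = (Y.marginal A).map fun y (i : C) => y ⟨i, h i.2⟩ := by
  rw [marginal, marginal, PMF.map_comp]; rfl

/-- The joint law of `Y i` and `(Y j, j ∈ A)`. -/
noncomputable def coordPair (i : N) (A : Set N) : PMF (Y.alphabet i × ∀ j : A, Y.alphabet j) :=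
  Y.law.map fun y => (y i, fun j => y j)

theorem coordPair_eq_map (i : N) (A : Set N) :
    Y.coordPair i A = (Y.marginal (insert i A)).map fun y =>
      (y ⟨i, Set.mem_insert i A⟩, fun j : A => y ⟨j, Set.mem_insert_of_mem i j.2⟩) := by
  rw [marginal, PMF.map_comp]; rfl

theorem coordPair_map_injective (i : N) (A : Set N) :
    Function.Injective fun y : ∀ j : ↥(insert i A), Y.alphabet j =>
      ((y ⟨i, Set.mem_insert i A⟩, fun j => y ⟨j, Set.mem_insert_of_mem i j.2⟩) :
        Y.alphabet i × ∀ j : A, Y.alphabet j) := by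
  intro y z h
  rw [Prod.mk.injEq] at h
  funext ⟨j, hj⟩
  rcases hj with rfl | hj
  · exact h.1
  · exact congrFun h.2 ⟨j, hj⟩

theorem tsum_coordPair (i : N) (A : Set N) :
    ∑' z, entropyTerm (Y.coordPair i A) z = Y.entropy (insert i A) := by
  rw [coordPair_eq_map, tsum_entropyTerm_map _ (Y.coordPair_map_injective i A).injOn]
  rfl

theorem single_eq_map (i : N) :
    Y.single i = (Y.marginal {i}).map fun y => y ⟨i, rfl⟩ := by
  rw [marginal, PMF.map_comp]; rfl

theorem single_map_injective (i : N) :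
    Function.Injective fun y : ∀ j : ({i} : Set N), Y.alphabet j => y ⟨i, rfl⟩ := by
  intro y z h
  funext ⟨j, hj⟩
  cases hj
  exact h

theorem tsum_single (i : N) : ∑' a, entropyTerm (Y.single i) a = Y.entropy {i} := by
  rw [single_eq_map, tsum_entropyTerm_map _ (Y.single_map_injective i).injOn]
  rfl

theorem coordPair_fst (i : N) (A : Set N) : (Y.coordPair i A).map Prod.fst = Y.single i := by
  rw [coordPair, PMF.map_comp]; rfl

theorem coordPair_snd (i : N) (A : Set N) : (Y.coordPair i A).map Prod.snd = Y.marginal A := by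
  rw [coordPair, PMF.map_comp]; rfl

theorem entropy_empty : Y.entropy ∅ = 0 := by
  have hfin : (Y.marginal ∅).support.Finite := Set.toFinite _
  refine le_antisymm ((tsum_entropyTerm_le_log _ hfin).trans ?_) (Y.entropy_nonneg ∅)
  have : (Y.marginal ∅).support.ncard ≤ 1 := Set.ncard_le_one_of_subsingleton _
  exact Real.log_nonpos (Nat.cast_nonneg _) (by exact_mod_cast this)

theorem entropy_single_of_isUniform {i : N} (h : Y.IsUniform i) :
    Y.entropy {i} = Real.log (Y.supp i).ncard := by
  rw [← tsum_single, tsum_entropyTerm_of_uniform (Y.single i) h]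
  rfl

theorem entropy_single_le_log {i : N} (h : (Y.supp i).Finite) :
    Y.entropy {i} ≤ Real.log (Y.supp i).ncard := by
  rw [← tsum_single]
  exact tsum_entropyTerm_le_log _ h

theorem finiteEntropy_of_finite_support (h : Y.law.support.Finite) : Y.FiniteEntropy := by
  intro A
  refine summable_entropyTerm_of_finite (Y.marginal A) ?_
  rw [marginal, PMF.support_map]
  exact h.image _

theorem entropy_le_log_ncard_support (h : Y.law.support.Finite) (A : Set N) :
    Y.entropy A ≤ Real.log Y.law.support.ncard := by
  have hs : (Y.marginal A).support = (fun y (i : A) => y i) '' Y.law.support := by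
    rw [marginal, PMF.support_map]
  have hfin : (Y.marginal A).support.Finite := hs ▸ h.image _
  refine (tsum_entropyTerm_le_log _ hfin).trans (Real.log_le_log ?_ ?_)
  · exact_mod_cast ncard_support_pos _ hfin
  · rw [hs]
    exact_mod_cast Set.ncard_image_le h

theorem entropy_eq_of_map_eq {α : N → Type} {μ ν : PMF (∀ i, α i)} {A B : Set N} (hAB : A ⊆ B)
    (h : (μ.map fun y (j : B) => y j) = ν.map fun y (j : B) => y j) :
    (RandomVars.mk α μ).entropy A = (RandomVars.mk α ν).entropy A := by
  have : (RandomVars.mk α μ).marginal A = (RandomVars.mk α ν).marginal A := by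
    rw [marginal_eq_map_of_subset _ hAB, marginal_eq_map_of_subset _ hAB, marginal, marginal, h]
  simp only [entropy, this]

/-- Fano's inequality for a member of a family. -/
theorem condRank_entropy_le_mul_log (i : N) (A : Set N)
    (hfin : (Y.coordPair i A).support.Finite)
    (g : (∀ j : A, Y.alphabet j) → Y.alphabet i) :
    condRank Y.entropy {i} A ≤
      (Real.binEntropy (Y.law.toOuterMeasure {y | y i ≠ g fun j => y j}).toReal / Real.log 2 +
        (Y.law.toOuterMeasure {y | y i ≠ g fun j => y j}).toReal) *
          Real.log (Y.supp i).ncard := by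
  have h := tsum_entropyTerm_sub_le_mul_log (Y.coordPair i A) hfin g
  rw [coordPair_fst, coordPair_snd, tsum_coordPair, coordPair,
    PMF.toOuterMeasure_map_apply] at h
  rw [condRank, Set.singleton_union]
  exact h

variable {Y} (hY : Y.FiniteEntropy)
include hY

theorem summable_coordPair (i : N) (A : Set N) : Summable (entropyTerm (Y.coordPair i A)) := by
  rw [coordPair_eq_map, summable_entropyTerm_map_iff _ (Y.coordPair_map_injective i A).injOn]
  exact hY _

theorem summable_single (i : N) : Summable (entropyTerm (Y.single i)) := by
  rw [single_eq_map, summable_entropyTerm_map_iff _ (Y.single_map_injective i).injOn]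
  exact hY _

theorem entropy_mono {A C : Set N} (h : C ⊆ A) : Y.entropy C ≤ Y.entropy A := by
  have := tsum_entropyTerm_map_le (Y.marginal A) (fun y (i : C) => y ⟨i, h i.2⟩) (hY A)
  rw [← marginal_eq_map_of_subset] at this
  exact this (hY C)

theorem entropy_insert_le (i : N) (A : Set N) :
    Y.entropy (insert i A) ≤ Y.entropy {i} + Y.entropy A := by
  have := tsum_entropyTerm_le_add (Y.coordPair i A) (summable_coordPair hY i A)
  rw [tsum_coordPair, coordPair_fst, coordPair_snd, tsum_single] at this
  exact this (summable_single hY i) (hY A)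

theorem isProd_coordPair_iff (i : N) (A : Set N) :
    IsProd (Y.coordPair i A) ↔ Y.entropy (insert i A) = Y.entropy {i} + Y.entropy A := by
  have h1 := tsum_entropyTerm_eq_of_isProd (Y.coordPair i A) (summable_coordPair hY i A)
  have h2 := isProd_of_tsum_entropyTerm_eq (Y.coordPair i A) (summable_coordPair hY i A)
  rw [tsum_coordPair, coordPair_fst, coordPair_snd, tsum_single] at h1 h2
  exact ⟨h1 (summable_single hY i) (hY A), h2 (summable_single hY i) (hY A)⟩

theorem entropy_le_sum (A : Finset N) : Y.entropy A ≤ ∑ i ∈ A, Y.entropy {i} := by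
  classical
  induction A using Finset.induction_on with
  | empty => simp [entropy_empty]
  | insert i A hi ih =>
    rw [Finset.sum_insert hi, Finset.coe_insert]
    exact (entropy_insert_le hY i A).trans (by gcongr)

/-- The entropy of a finite subfamily is the sum of the single entropies precisely if each
variable is independent of the others. -/
theorem entropy_eq_sum_iff (T : Finset N) :
    Y.entropy T = ∑ i ∈ T, Y.entropy {i} ↔ ∀ i ∈ T, IndepCoord Y.law (T : Set N) i := by
  classical
  constructor
  · intro h i hi
    refine (isProd_coordPair_iff hY i ((T : Set N) \ {i})).2 ?_
    -- The sum of the single entropies is reached through two applications of subadditivity, so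
    -- splitting off `i` must lose nothing.
    have hle := entropy_insert_le hY i ((T : Set N) \ {i})
    have hT : insert i ((T : Set N) \ {i}) = T := by
      rw [Set.insert_sdiff_singleton, Set.insert_eq_of_mem (Finset.mem_coe.2 hi)]
    have hsum := entropy_le_sum hY (T.erase i)
    rw [Finset.coe_erase] at hsum
    rw [← Finset.add_sum_erase T _ hi] at h
    rw [hT] at hle ⊢
    linarith
  · intro h
    have hall : ∀ A : Finset N, A ⊆ T → Y.entropy A = ∑ i ∈ A, Y.entropy {i} := by
      intro A
      induction A using Finset.induction_on with
      | empty => simp [entropy_empty]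
      | insert i A hi ih =>
        intro hA
        rw [Finset.insert_subset_iff] at hA
        have hsub : ∀ j ∈ (A : Set N), j ∈ (T : Set N) \ {i} := fun j hj =>
          ⟨hA.2 hj, fun hji => hi (by rw [Set.mem_singleton_iff] at hji; exact hji ▸ hj)⟩
        have hp : IsProd (Y.coordPair i A) := by
          have := (h i hA.1).map_snd fun (z : ∀ j : ↥((T : Set N) \ {i}), Y.alphabet j)
            (j : (A : Set N)) => z ⟨j, hsub j j.2⟩
          rwa [PMF.map_comp] at this
        rw [Finset.coe_insert, Finset.sum_insert hi, ← ih hA.2]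
        exact (isProd_coordPair_iff hY i A).1 hp
    exact hall T subset_rfl

/-- Vanishing conditional entropy means functional dependence on the support. -/
theorem condRank_entropy_eq_zero_iff (A C : Set N) :
    condRank Y.entropy A C = 0 ↔ ∀ y ∈ Y.law.support, ∀ z ∈ Y.law.support,
      (∀ i ∈ C, y i = z i) → ∀ i ∈ A, y i = z i := by
  set ρ : (∀ i : ↥(A ∪ C), Y.alphabet i) → ∀ i : C, Y.alphabet i :=
    fun y i => y ⟨i, Or.inr i.2⟩ with hρ
  have hC : Y.marginal C = (Y.marginal (A ∪ C)).map ρ :=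
    Y.marginal_eq_map_of_subset Set.subset_union_right
  have hiff : condRank Y.entropy A C = 0 ↔ Set.InjOn ρ (Y.marginal (A ∪ C)).support := by
    have hCs : Summable (entropyTerm ((Y.marginal (A ∪ C)).map ρ)) := hC ▸ hY C
    have hCe : Y.entropy C = ∑' b, entropyTerm ((Y.marginal (A ∪ C)).map ρ) b := by
      rw [← hC]; rfl
    rw [condRank, sub_eq_zero, hCe]
    exact ⟨fun h => injOn_support_of_tsum_entropyTerm_map_eq _ ρ (hY (A ∪ C)) hCs h.symm,
      fun h => (tsum_entropyTerm_map _ h).symm⟩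
  rw [hiff, marginal, PMF.support_map]
  constructor
  · intro h y hy z hz hyz i hi
    have := h ⟨y, hy, rfl⟩ ⟨z, hz, rfl⟩ (funext fun j => hyz j j.2)
    exact congrFun this ⟨i, Or.inl hi⟩
  · rintro h _ ⟨y, hy, rfl⟩ _ ⟨z, hz, rfl⟩ hyz
    have hyz' : ∀ i ∈ C, y i = z i := fun i hi => congrFun hyz ⟨i, hi⟩
    funext ⟨i, hi⟩
    exact hi.elim (fun hA => h y hy z hz hyz' i hA) (hyz' i)

end RandomVars

/-! ### The outer bound -/

section Idx

variable {V E S R : Type*}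

/-- The indices of sources and hyperedges. -/
def messages (V E S : Type*) [Fintype E] [Fintype S] : Finset (Idx V E S) :=
  Finset.univ.disjSum (Finset.univ.disjSum ∅)

/-- The indices of sources and nodes. -/
def inputs (V E S : Type*) [Fintype V] [Fintype S] : Finset (Idx V E S) :=
  Finset.univ.disjSum ((∅ : Finset E).disjSum Finset.univ)

theorem mem_messages_src [Fintype E] [Fintype S] (s : S) : src s ∈ messages V E S := by
  simp [messages, src]

theorem mem_messages_edge [Fintype E] [Fintype S] (e : E) : edge e ∈ messages V E S := by
  simp [messages, edge]

theorem coe_inputs [Fintype V] [Fintype S] :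
    (inputs V E S : Set (Idx V E S)) = Set.range src ∪ Set.range node := by
  ext (s | e | u) <;> simp [inputs, src, node]

theorem sum_messages [Fintype E] [Fintype S] (f : Idx V E S → ℝ) :
    ∑ i ∈ messages V E S, f i = ∑ s, f (src s) + ∑ e, f (edge e) := by
  simp [messages, Finset.sum_disjSum, src, edge]

theorem sum_inputs [Fintype V] [Fintype S] (f : Idx V E S → ℝ) :
    ∑ i ∈ inputs V E S, f i = ∑ s, f (src s) + ∑ u, f (node u) := by
  simp [inputs, Finset.sum_disjSum, src, node]

theorem Problem.inc_subset_messages [Fintype E] [Fintype S] (P : Problem V E S R) (u : V) :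
    P.inc u ⊆ messages V E S := by
  rintro _ (⟨s, _, rfl⟩ | ⟨e, _, rfl⟩)
  · exact mem_messages_src s
  · exact mem_messages_edge e

end Idx

namespace Problem

variable {V E S R : Type*} [Fintype V] [Fintype S] (P : Problem V E S R)

theorem mem_CI_iff_forall_indepCoord {Y : RandomVars (Idx V E S)} (hY : Y.FiniteEntropy) :
    Y.entropy ∈ P.CI ↔
      ∀ i ∈ inputs V E S, IndepCoord Y.law (inputs V E S : Set (Idx V E S)) i := by
  rw [← RandomVars.entropy_eq_sum_iff hY, sum_inputs, coe_inputs]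
  rfl

variable [Fintype E]

/-- The total logarithmic size of the source and hyperedge alphabets. -/
noncomputable def logSize (Y : RandomVars (Idx V E S)) : ℝ :=
  ∑ s, Real.log (Y.supp (src s)).ncard + ∑ e, Real.log (Y.supp (edge e)).ncard

/-- The local keys of a stochastic network code can be replaced by keys whose size is controlled
by the source and hyperedge alphabets, without changing the joint law of sources and messages. -/
theorem exists_reduced_keys {Y : RandomVars (Idx V E S)} (hY : P.IsStochasticCode Y)
    (hfin : ∀ i ∈ messages V E S, (Y.supp i).Finite) :
    ∃ Y' : RandomVars (Idx V E S), Y'.FiniteEntropy ∧ Y'.entropy ∈ P.CI ∧ Y'.entropy ∈ P.CT ∧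
      (∀ A ⊆ (messages V E S : Set (Idx V E S)), Y'.entropy A = Y.entropy A) ∧
      ∀ A, Y'.entropy A ≤ (1 + Fintype.card V) * logSize Y := by
  classical
  have hBi : ∀ i : (messages V E S : Set (Idx V E S)), (Y.marginal (messages V E S)).map
      (fun y => y i) = Y.single i := by
    intro i
    rw [RandomVars.marginal, PMF.map_comp]; rfl
  have hBi' : ∀ i : (messages V E S : Set (Idx V E S)),
      ((Y.marginal (messages V E S)).map fun y => y i).support.Finite := by
    intro i
    rw [hBi]
    exact hfin i i.2
  have hB : (Y.marginal (messages V E S)).support.Finite := finite_support_of_forall_coord _ hBi'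
  have hBlog : Real.log (Y.marginal (messages V E S)).support.ncard ≤ logSize Y := by
    refine (log_ncard_support_le_sum _ hBi').trans (le_of_eq ?_)
    rw [logSize, ← sum_messages fun i => Real.log (Y.supp i).ncard,
      Finset.sum_subtype (p := fun i => i ∈ (messages V E S : Set (Idx V E S))) _ fun i => Iff.rfl]
    refine Finset.sum_congr rfl fun i _ => ?_
    rw [hBi]
    rfl
  obtain ⟨μ, hsub, hμB, hind, hkey⟩ := exists_reduce_coords Y.law (messages V E S)
    (inputs V E S) (Finset.univ.map ⟨node, fun a b h => by simpa [node] using h⟩) (by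
      intro i hi
      simp only [Finset.coe_map, Finset.coe_univ, Set.image_univ] at hi
      rw [coe_inputs]
      exact Or.inr hi) hB
  have hkey' : ∀ u : V, (μ.map fun y => y (node u)).support.Finite ∧
      (μ.map fun y => y (node u)).support.ncard ≤ (Y.marginal (messages V E S)).support.ncard :=
    fun u => hkey (node u) (Finset.mem_map.2 ⟨u, Finset.mem_univ u, rfl⟩)
  have hmsg : ∀ i ∈ messages V E S, (μ.map fun y => y i).support ⊆ Y.supp i := fun i _ =>
    support_map_mono hsub _
  have hfin' : ∀ i, (μ.map fun y => y i).support.Finite := by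
    rintro (s | e | u)
    · exact (hfin _ (mem_messages_src s)).subset (hmsg _ (mem_messages_src s))
    · exact (hfin _ (mem_messages_edge e)).subset (hmsg _ (mem_messages_edge e))
    · exact (hkey' u).1
  have hsupp : μ.support.Finite := finite_support_of_forall_coord _ hfin'
  have hFE : (RandomVars.mk Y.alphabet μ).FiniteEntropy :=
    RandomVars.finiteEntropy_of_finite_support _ hsupp
  refine ⟨⟨Y.alphabet, μ⟩, hFE, ?_, ?_, fun A hA => RandomVars.entropy_eq_of_map_eq hA hμB,
    fun A => (RandomVars.entropy_le_log_ncard_support _ hsupp A).trans ?_⟩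
  · rw [P.mem_CI_iff_forall_indepCoord hFE]
    intro i hi
    exact hind i hi ((P.mem_CI_iff_forall_indepCoord hY.finiteEntropy).1 hY.independent i hi)
  -- Functional dependence is a condition on pairs of support points, so it is inherited by the
  -- smaller support.
  · intro e
    rw [RandomVars.condRank_entropy_eq_zero_iff hFE]
    intro y hy z hz
    exact (RandomVars.condRank_entropy_eq_zero_iff hY.finiteEntropy _ _).1 (hY.topology e)
      y (hsub hy) z (hsub hz)
  -- Sources and edges together contribute at most one `logSize Y`, and each of the `|V|` keys at
  -- most another.
  · refine (log_ncard_support_le_sum μ hfin').trans ?_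
    have hlog : ∀ i ∈ messages V E S, Real.log (μ.map fun y => y i).support.ncard ≤
        Real.log (Y.supp i).ncard := fun i hi =>
      Real.log_le_log (by exact_mod_cast ncard_support_pos _ (hfin' i))
        (by exact_mod_cast Set.ncard_le_ncard (hmsg i hi) (hfin i hi))
    have hnode : ∀ u : V, Real.log (μ.map fun y => y (node u)).support.ncard ≤ logSize Y :=
      fun u => (Real.log_le_log (by exact_mod_cast ncard_support_pos _ (hfin' _))
        (by exact_mod_cast (hkey' u).2)).trans hBlog
    have h1 := Finset.sum_le_sum hlog
    have h2 := Finset.sum_le_sum fun u (_ : u ∈ (Finset.univ : Finset V)) => hnode u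
    rw [sum_messages, sum_messages] at h1
    rw [Finset.sum_const, Finset.card_univ, nsmul_eq_mul] at h2
    rw [Fintype.sum_sum_type, Fintype.sum_sum_type]
    simp only [src, edge, node, logSize] at h1 h2 ⊢
    linarith

theorem isStochasticCode_finite_supp {Y : RandomVars (Idx V E S)} (hY : P.IsStochasticCode Y)
    (hE : ∀ e, (Y.supp (edge e)).Finite) : ∀ i ∈ messages V E S, (Y.supp i).Finite := by
  rintro (s | e | u) hi
  · exact finite_support_of_uniform _ (hY.uniform s)
  · exact hE e
  · simp [messages] at hi

/-- Equivocation of a source at a sink, bounded by the decoding error. -/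
theorem condRank_source_le {Y : RandomVars (Idx V E S)} (hY : P.IsStochasticCode Y)
    (hE : ∀ e, (Y.supp (edge e)).Finite) (s : S) (u : V)
    (g : (∀ f : P.inc u, Y.alphabet f) → Y.alphabet (src s)) :
    condRank Y.entropy {src s} (P.inc u) ≤
      (Real.binEntropy (Y.law.toOuterMeasure {y | y (src s) ≠ g fun f => y f}).toReal / Real.log 2 +
        (Y.law.toOuterMeasure {y | y (src s) ≠ g fun f => y f}).toReal) *
          Real.log (Y.supp (src s)).ncard := by
  classical
  have hfin := P.isStochasticCode_finite_supp hY hE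
  have : Finite (P.inc u) := (Finset.finite_toSet _).subset (P.inc_subset_messages u)
  have : Fintype (P.inc u) := Fintype.ofFinite _
  refine Y.condRank_entropy_le_mul_log _ _ ?_ g
  have h1 : (Y.marginal (P.inc u)).support.Finite := by
    refine finite_support_of_forall_coord _ fun i => ?_
    rw [RandomVars.marginal, PMF.map_comp]
    exact hfin i (P.inc_subset_messages u i.2)
  refine ((hfin _ (mem_messages_src s)).prod h1).subset ?_
  intro z hz
  refine ⟨?_, ?_⟩
  · have := map_apply_ne_zero _ Prod.fst hz
    rwa [RandomVars.coordPair_fst] at this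
  · have := map_apply_ne_zero _ Prod.snd hz
    rwa [RandomVars.coordPair_snd] at this

theorem exists_mem_outerRegion {t : Tuple E S} (h : P.EpsAchievable t) :
    ∃ h ∈ P.outerRegion, (∀ s, t.1 s ≤ h {src s}) ∧ ∀ e, h {edge e} ≤ t.2 e := by
  obtain ⟨Y, c, hcode, hc, hE, hedge, hsrc, hdec, hsec⟩ := h
  choose Y' hFE hCI hCT hent hbound using fun n =>
    P.exists_reduced_keys (hcode n) (P.isStochasticCode_finite_supp (hcode n) (hE n))
  choose le hle hle' using hedge
  choose ls hls hls' using hsrc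
  have hsize : Tendsto (fun n => c n * logSize (Y n)) atTop (𝓝 (∑ s, ls s + ∑ e, le e)) := by
    simp_rw [logSize, mul_add, Finset.mul_sum]
    exact (tendsto_finsetSum _ fun s _ => hls s).add (tendsto_finsetSum _ fun e _ => hle e)
  -- The scaled sizes converge, hence are bounded; this gives the side of the compact box.
  obtain ⟨M, hM⟩ := hsize.bddAbove_range
  set x : ℕ → RankFun (Idx V E S) := fun n => c n • (Y' n).entropy with hx
  set K : Set (RankFun (Idx V E S)) :=
    Set.univ.pi fun _ => Set.Icc 0 ((1 + Fintype.card V) * M) with hK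
  have hxK : ∀ n, x n ∈ K := by
    intro n A _
    refine ⟨mul_nonneg (hc n).le ((Y' n).entropy_nonneg A), ?_⟩
    calc c n * (Y' n).entropy A ≤ c n * ((1 + Fintype.card V) * logSize (Y n)) :=
          mul_le_mul_of_nonneg_left (hbound n A) (hc n).le
      _ = (1 + Fintype.card V) * (c n * logSize (Y n)) := by ring
      _ ≤ (1 + Fintype.card V) * M :=
          mul_le_mul_of_nonneg_left (hM ⟨n, rfl⟩) (by positivity)
  have hKc : IsCompact K := isCompact_univ_pi fun _ => isCompact_Icc
  obtain ⟨h, -, φ, hφ, hlim⟩ := hKc.tendsto_subseq hxK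
  have hat : ∀ A, Tendsto (fun n => x (φ n) A) atTop (𝓝 (h A)) := fun A =>
    (tendsto_pi_nhds.1 hlim) A
  have hmsg : ∀ n A, A ⊆ (messages V E S : Set (Idx V E S)) →
      x n A = c n * (Y n).entropy A := by
    intro n A hA
    rw [hx, ← hent n A hA]; rfl
  have hs1 : ∀ s, ({src s} : Set (Idx V E S)) ⊆ messages V E S := fun s =>
    Set.singleton_subset_iff.2 (mem_messages_src s)
  have he1 : ∀ e, ({edge e} : Set (Idx V E S)) ⊆ messages V E S := fun e =>
    Set.singleton_subset_iff.2 (mem_messages_edge e)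
  refine ⟨h, ⟨⟨⟨⟨⟨fun n => x (φ n), fun n => ⟨(c (φ n))⁻¹, inv_pos.2 (hc _), Y' (φ n), hFE _, ?_⟩,
    hlim⟩, ?_⟩, ?_⟩, ?_⟩, ?_⟩, fun s => ?_, fun e => ?_⟩
  · rw [hx]
    exact inv_smul_smul₀ (hc _).ne' _
  · have hz : ∀ n, x n (Set.range src ∪ Set.range node) =
        ∑ s : S, x n {src s} + ∑ u : V, x n {node u} := by
      intro n
      have := hCI n
      simp only [CI, Set.mem_ofPred_eq] at this
      simp only [hx, Pi.smul_apply, smul_eq_mul, this, mul_add, Finset.mul_sum]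
    refine tendsto_nhds_unique (hat _) ?_
    simp_rw [hz]
    exact (tendsto_finsetSum _ fun s _ => hat _).add (tendsto_finsetSum _ fun u _ => hat _)
  · intro e
    have hz : ∀ n, x n ({edge e} ∪ (P.inc (P.tail e) ∪ {node (P.tail e)})) -
        x n (P.inc (P.tail e) ∪ {node (P.tail e)}) = 0 := by
      intro n
      have := hCT n e
      rw [condRank] at this
      simp only [hx, Pi.smul_apply, smul_eq_mul]
      rw [← mul_sub, this, mul_zero]
    refine tendsto_nhds_unique ((hat _).sub (hat _)) ?_
    simp_rw [hz]
    exact tendsto_const_nhds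
  -- Only sources and edges enter here, so entropies of the original codes may be used. Fano's bound
  -- is a factor tending to 0 times the convergent `c n * log |SP|`.
  · intro s u hu
    obtain ⟨g, hg⟩ := hdec s u hu
    have hpe : Tendsto (fun n => ((Y n).law.toOuterMeasure
        {y | y (src s) ≠ g n fun f => y f}).toReal) atTop (𝓝 0) := by
      exact (ENNReal.tendsto_toReal ENNReal.zero_ne_top).comp hg
    have hb : Tendsto (fun n => (Real.binEntropy ((Y n).law.toOuterMeasure
        {y | y (src s) ≠ g n fun f => y f}).toReal / Real.log 2 + ((Y n).law.toOuterMeasure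
        {y | y (src s) ≠ g n fun f => y f}).toReal) *
          (c n * Real.log ((Y n).supp (src s)).ncard)) atTop (𝓝 0) := by
      have h1 := (Real.binEntropy_continuous.tendsto 0).comp hpe
      rw [Real.binEntropy_zero] at h1
      simpa using ((h1.div_const (Real.log 2)).add hpe).mul (hls s)
    have hz : Tendsto (fun n => x n ({src s} ∪ P.inc u) - x n (P.inc u)) atTop (𝓝 0) := by
      have hu' := P.inc_subset_messages u
      refine squeeze_zero (fun n => ?_) (fun n => ?_) hb
      · rw [hmsg n _ hu', hmsg n _ (Set.union_subset (hs1 s) hu'), ← mul_sub]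
        exact mul_nonneg (hc n).le (sub_nonneg.2
          (RandomVars.entropy_mono (hcode n).finiteEntropy Set.subset_union_right))
      · rw [hmsg n _ hu', hmsg n _ (Set.union_subset (hs1 s) hu'), ← mul_sub]
        refine (mul_le_mul_of_nonneg_left
          (P.condRank_source_le (hcode n) (hE n) s u (g n)) (hc n).le).trans (le_of_eq ?_)
        ring
    exact tendsto_nhds_unique ((hat _).sub (hat _)) (hz.comp hφ.tendsto_atTop)
  · intro r
    have hA : (src '' P.target r : Set (Idx V E S)) ⊆ messages V E S := by
      rintro _ ⟨s, _, rfl⟩; exact mem_messages_src s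
    have hB : (edge '' P.wiretap r : Set (Idx V E S)) ⊆ messages V E S := by
      rintro _ ⟨e, _, rfl⟩; exact mem_messages_edge e
    refine tendsto_nhds_unique (((hat _).add (hat _)).sub (hat _))
      (((hsec r).comp hφ.tendsto_atTop).congr fun n => ?_)
    rw [hmsg _ _ hA, hmsg _ _ hB, hmsg _ _ (Set.union_subset hA hB), Function.comp_apply,
      mutualRank]
    ring
  -- Uniformity makes the source entropy equal to the logarithm of its support size; for edges below
  -- only an upper bound holds, and it has the right direction.
  · refine (hls' s).trans (le_of_eq (tendsto_nhds_unique
      ((hls s).comp hφ.tendsto_atTop) ((hat _).congr fun n => ?_)))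
    rw [hmsg _ _ (hs1 s), RandomVars.entropy_single_of_isUniform _ ((hcode _).uniform s)]
    rfl
  · refine (le_of_tendsto_of_tendsto' (hat _) ((hle e).comp hφ.tendsto_atTop)
      fun n => ?_).trans (hle' e)
    rw [hmsg _ _ (he1 e)]
    exact mul_le_mul_of_nonneg_left (RandomVars.entropy_single_le_log _ (hE _ e)) (hc _).le

end Problem

end SecureNC

theorem mainTheorem7 {V E S R : Type*} [Fintype V] [Fintype E] [Fintype S]
    (P : SecureNC.Problem V E S R) (t : SecureNC.Tuple E S)
    (ht : t ∈ SecureNC.rateCapacity E S) (hach : P.EpsAchievable t) :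
    (∃ h ∈ P.outerRegion, (∀ s, t.1 s ≤ h {SecureNC.src s}) ∧
      (∀ e, h {SecureNC.edge e} ≤ t.2 e)) ∧
    t ∈ SecureNC.CL (SecureNC.proj '' P.outerRegion) := by
  obtain ⟨h, hh, hs, he⟩ := P.exists_mem_outerRegion hach
  -- Scaling is already absorbed in `h`, so a constant sequence with factor 1 witnesses membership
  -- in `CL`.
  refine ⟨⟨h, hh, hs, he⟩, ht, fun _ => SecureNC.proj h, fun _ => 1, fun _ => ⟨h, hh, rfl⟩,
    fun _ => one_pos, fun e => ⟨h {SecureNC.edge e}, ?_, he e⟩,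
    fun s => ⟨h {SecureNC.src s}, ?_, hs s⟩⟩
  · simp [SecureNC.proj]
  · simp [SecureNC.proj]
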